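/- Let $n,m,p\ge 0$ be integers, $T\ge 0$, and let $U\subseteq\mathbb R^m$, $V\subseteq\mathbb R^p$ be nonempty compact sets. Let $f:\mathbb R^n\times U\times V\to\mathbb R^n$ be bounded, Lipschitz in $x$ with a constant independent of $(u,v)\in U\times V$, and, for each fixed $x$, continuous in $u\in U$ and continuous in $v\in V$. Let $l,h:\mathbb R^n\to\mathbb R$ be bounded and Lipschitz. For $t\in[0,T]$ let $\mathcal U_{[t,T]}$ and $\mathcal V_{[t,T]}$ be the sets of Lebesgue measurable functions from $[t,T]$ to $U$ and to $V$, and let $\Gamma_{[t,T]}$ be the set of non-anticipative strategies, that is, of maps $\gamma:\mathcal V_{[t,T]}\to\mathcal U_{[t,T]}$ such that for all $s\in[t,T]$ and $v,\hat v\in\mathcal V_{[t,T]}$, if $v=\hat v$ almost everywhere on $[t,s]$, then $\gamma[v]=\gamma[\hat v]$ almost everywhere on $[t,s]$. Then for all $x\in\mathbb R^n$, $t\in[0,T]$, $u\in\mathcal U_{[t,T]}$, $v\in\mathcal V_{[t,T]}$ there is exactly one absolutely continuous function $\phi(\cdot,t,x,u,v):[t,T]\to\mathbb R^n$ with $\phi(\tau)=x+\int_t^\tau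 f(\phi(s),u(s),v(s))\,ds$ for all $\tau\in[t,T]$, and the value function $$\mathcal V(x,t)=\inf_{\gamma\in\Gamma_{[t,T]}}\ \sup_{v\in\mathcal V_{[t,T]}}\ \max\Big\{\, l\big(\phi(T,t,x,\gamma[v],v)\big),\ \max_{\tau\in[t,T]}h\big(\phi(\tau,t,x,\gamma[v],v)\big)\Big\}$$ is the unique continuous viscosity solution on $\mathbb R^n\times[0,T]$ of $$\max\Big\{h(x)-w(x,t),\ \frac{\partial w}{\partial t}(x,t)+\sup_{v\in V}\inf_{u\in U}\frac{\partial w}{\partial x}(x,t)\,f(x,u,v)\Big\}=0$$ with terminal condition $w(x,T)=\max\{l(x),h(x)\}$ for all $x\in\mathbb R^n$. Here a continuous function $w:\mathbb R^n\times[0,T]\to\mathbb R$ is called a viscosity solution if for every $C^\infty$ function $W:\mathbb R^n\times(0,T)\to\mathbb R$ and every $(x_0,t_0)\in\mathbb R^n\times(0,T)$ the quantity $$\max\Big\{h(x_0)-w(x_0,t_0),\ \frac{\partial W}{\partial t}(x_0,t_0)+\sup_{v\in V}\inf_{u\in U}\frac{\partial W}{\partial x}(x_0,t_0)\,f(x_0,u,v)\Big\}$$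 is $\ge 0$ whenever $w-W$ has a local maximum at $(x_0,t_0)$, and is $\le 0$ whenever $w-W$ has a local minimum at $(x_0,t_0)$. -/

import Mathlib

open Set MeasureTheory
open scoped ContDiff

noncomputable section

namespace ReachAvoid

variable {n m p k : ℕ}

/-- The Lebesgue measurable functions from `[t, T]` to `U`. A function on `[t, T]` is represented
by a function on `ℝ` whose values off `[t, T]` play no role. For maps into a Euclidean space,
measurability with respect to the Lebesgue (completed) σ-algebra is `AEMeasurable`. -/
def inputs (U : Set (EuclideanSpace ℝ (Fin k))) (t T : ℝ) :
    Set (ℝ → EuclideanSpace ℝ (Fin k)) :=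
  {u | AEMeasurable u (volume.restrict (Icc t T)) ∧ ∀ τ ∈ Icc t T, u τ ∈ U}

/-- A strategy on `[t, T]` is non-anticipative if, for every `s ∈ [t, T]`, disturbances that agree
almost everywhere on `[t, s]` get answers that agree almost everywhere on `[t, s]`. -/
def IsNonanticipative {U : Set (EuclideanSpace ℝ (Fin m))} {V : Set (EuclideanSpace ℝ (Fin p))}
    {t T : ℝ} (γ : inputs V t T → inputs U t T) : Prop :=
  ∀ s ∈ Icc t T, ∀ v v' : inputs V t T,
    (∀ᵐ τ ∂(volume.restrict (Icc t s)), v.1 τ = v'.1 τ) →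
    ∀ᵐ τ ∂(volume.restrict (Icc t s)), (γ v).1 τ = (γ v').1 τ

/-- The class of non-anticipative strategies on `[t, T]`. -/
def strategies (U : Set (EuclideanSpace ℝ (Fin m))) (V : Set (EuclideanSpace ℝ (Fin p)))
    (t T : ℝ) : Set (inputs V t T → inputs U t T) :=
  {γ | IsNonanticipative γ}

/-- `y` solves `y' = f (y, u, v)` almost everywhere on `[t, T]`, with `y t = x`, in integrated
form; in particular `y` is absolutely continuous on `[t, T]`. -/
def IsTrajectory
    (f : EuclideanSpace ℝ (Fin n) → EuclideanSpace ℝ (Fin m) → EuclideanSpace ℝ (Fin p) →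
      EuclideanSpace ℝ (Fin n))
    (t T : ℝ) (x : EuclideanSpace ℝ (Fin n))
    (u : ℝ → EuclideanSpace ℝ (Fin m)) (v : ℝ → EuclideanSpace ℝ (Fin p))
    (y : ℝ → EuclideanSpace ℝ (Fin n)) : Prop :=
  IntervalIntegrable (fun s => f (y s) (u s) (v s)) volume t T ∧
    ∀ τ ∈ Icc t T, y τ = x + ∫ s in t..τ, f (y s) (u s) (v s)

/-- The trajectory on `[t, T]` that starts at `x` at time `t` (its values off `[t, T]` are
arbitrary). -/
def trajectory
    (f : EuclideanSpace ℝ (Fin n) → EuclideanSpace ℝ (Fin m) → EuclideanSpace ℝ (Fin p) →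
      EuclideanSpace ℝ (Fin n))
    (t T : ℝ) (x : EuclideanSpace ℝ (Fin n))
    (u : ℝ → EuclideanSpace ℝ (Fin m)) (v : ℝ → EuclideanSpace ℝ (Fin p)) :
    ℝ → EuclideanSpace ℝ (Fin n) :=
  Classical.epsilon (IsTrajectory f t T x u v)

/-- `max {l (y T), max over τ ∈ [t, T] of h (y τ)}`. -/
def payoff (l h : EuclideanSpace ℝ (Fin n) → ℝ) (t T : ℝ)
    (y : ℝ → EuclideanSpace ℝ (Fin n)) : ℝ :=
  max (l (y T)) (sSup ((fun τ => h (y τ)) '' Icc t T))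

/-- The value function, as a function of `z = (x, t)`. -/
def value
    (f : EuclideanSpace ℝ (Fin n) → EuclideanSpace ℝ (Fin m) → EuclideanSpace ℝ (Fin p) →
      EuclideanSpace ℝ (Fin n))
    (l h : EuclideanSpace ℝ (Fin n) → ℝ)
    (U : Set (EuclideanSpace ℝ (Fin m))) (V : Set (EuclideanSpace ℝ (Fin p)))
    (T : ℝ) (z : EuclideanSpace ℝ (Fin n) × ℝ) : ℝ :=
  ⨅ γ : strategies U V z.2 T, ⨆ v : inputs V z.2 T,
    payoff l h z.2 T (trajectory f z.2 T z.1 (γ.1 v).1 v.1)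

/-- The Hamiltonian `sup over v ∈ V of inf over u ∈ U of q · f (x, u, v)`, for a covector `q`. -/
def hamiltonian
    (f : EuclideanSpace ℝ (Fin n) → EuclideanSpace ℝ (Fin m) → EuclideanSpace ℝ (Fin p) →
      EuclideanSpace ℝ (Fin n))
    (U : Set (EuclideanSpace ℝ (Fin m))) (V : Set (EuclideanSpace ℝ (Fin p)))
    (x : EuclideanSpace ℝ (Fin n)) (q : EuclideanSpace ℝ (Fin n) →L[ℝ] ℝ) : ℝ :=
  ⨆ v : V, ⨅ u : U, q (f x u v)

/-- `max {h x - r, ∂W/∂t (x, t) + sup over v of inf over u of ∂W/∂x (x, t) f (x, u, v)}`. -/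
def viExpr
    (f : EuclideanSpace ℝ (Fin n) → EuclideanSpace ℝ (Fin m) → EuclideanSpace ℝ (Fin p) →
      EuclideanSpace ℝ (Fin n))
    (h : EuclideanSpace ℝ (Fin n) → ℝ)
    (U : Set (EuclideanSpace ℝ (Fin m))) (V : Set (EuclideanSpace ℝ (Fin p)))
    (W : EuclideanSpace ℝ (Fin n) × ℝ → ℝ)
    (x : EuclideanSpace ℝ (Fin n)) (t r : ℝ) : ℝ :=
  max (h x - r)
    (deriv (fun s => W (x, s)) t + hamiltonian f U V x (fderiv ℝ (fun y => W (y, t)) x))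

/-- `w` is a continuous viscosity solution on `ℝⁿ × [0, T]` of
`max {h - w, ∂w/∂t + sup over v of inf over u of ∂w/∂x f} = 0`. This is the sign convention of
terminal value problems: `≥ 0` where `w - W` has a local maximum and `≤ 0` where it has a local
minimum, for test functions `W` that are smooth on `ℝⁿ × (0, T)`. -/
structure IsViscositySolution
    (f : EuclideanSpace ℝ (Fin n) → EuclideanSpace ℝ (Fin m) → EuclideanSpace ℝ (Fin p) →
      EuclideanSpace ℝ (Fin n))
    (h : EuclideanSpace ℝ (Fin n) → ℝ)
    (U : Set (EuclideanSpace ℝ (Fin m))) (V : Set (EuclideanSpace ℝ (Fin p)))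
    (T : ℝ) (w : EuclideanSpace ℝ (Fin n) × ℝ → ℝ) : Prop where
  continuousOn : ContinuousOn w (univ ×ˢ Icc 0 T)
  of_isLocalMax : ∀ W : EuclideanSpace ℝ (Fin n) × ℝ → ℝ,
    ContDiffOn ℝ ∞ W (univ ×ˢ Ioo 0 T) → ∀ x : EuclideanSpace ℝ (Fin n), ∀ t ∈ Ioo 0 T,
    IsLocalMax (fun z => w z - W z) (x, t) → 0 ≤ viExpr f h U V W x t (w (x, t))
  of_isLocalMin : ∀ W : EuclideanSpace ℝ (Fin n) × ℝ → ℝ,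
    ContDiffOn ℝ ∞ W (univ ×ˢ Ioo 0 T) → ∀ x : EuclideanSpace ℝ (Fin n), ∀ t ∈ Ioo 0 T,
    IsLocalMin (fun z => w z - W z) (x, t) → viExpr f h U V W x t (w (x, t)) ≤ 0

end ReachAvoid

end

/-!
The value function is characterized through *secured levels*: `value (x, t) < a` gives a strategy
that keeps the payoff at most `a` against every disturbance (`exists_secures`), and a strategy
doing so bounds the value by `a` (`value_le`).

Trajectories exist because the Picard map, conjugated with an exponential weight, is a contraction;
the velocity is measurable because a map that is continuous in each argument separately is Borel.
Trajectories up to time `t'` depend only on the inputs up to `t'`, so inputs and strategies can be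
cut and glued at `t'`. This yields the two halves of the dynamic programming principle
(`value_le_of_value_lt` and `Secures.value_le`), and from it Lipschitz continuity of the value.

At a local extremum of `value - W`, the principle is applied on a short interval, on which `W` grows
along trajectories at the rate given by its differential at the base point (`eventually_sub_le`). If
the equation failed at a local maximum, a measurable feedback, glued from finitely many constant
controls by compactness of `V`, would beat the value; if it failed at a local minimum, a constant
disturbance would.

Uniqueness is a comparison principle (`le_of_isViscositySolution`), proved by doubling the
variables. The competing solutions are arbitrary continuous functions, without any growth condition,
but `f` is bounded, so information travels at finite speed: a barrier that is large outside a cone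
opening towards later times confines the maximum of the doubled functional to a compact set
(`exists_doubled_max`), and it only helps in the inequality between the two Hamiltonians, being a
strict supersolution of `∂w/∂t + C ‖∂w/∂x‖ = 0` (`hasFDerivAt_barrier`).
-/

namespace ReachAvoid

variable {n m p k : ℕ} {U : Set (EuclideanSpace ℝ (Fin m))} {V : Set (EuclideanSpace ℝ (Fin p))}
  {f : EuclideanSpace ℝ (Fin n) → EuclideanSpace ℝ (Fin m) → EuclideanSpace ℝ (Fin p) →
    EuclideanSpace ℝ (Fin n)}
  {l h : EuclideanSpace ℝ (Fin n) → ℝ} {a b B K C L s t t' T : ℝ}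
  {x x' : EuclideanSpace ℝ (Fin n)}
  {u u' : ℝ → EuclideanSpace ℝ (Fin m)} {v v' : ℝ → EuclideanSpace ℝ (Fin p)}
  {y y' : ℝ → EuclideanSpace ℝ (Fin n)} {q q' : EuclideanSpace ℝ (Fin n) →L[ℝ] ℝ}
  {W w₁ w₂ : EuclideanSpace ℝ (Fin n) × ℝ → ℝ} {D : EuclideanSpace ℝ (Fin n) × ℝ →L[ℝ] ℝ}

/-! ### Carathéodory trajectories -/

/-- The standing assumptions on the dynamics: on nonempty control sets, `f` is bounded by `C`,
`L`-Lipschitz in the state uniformly in the controls, and separately continuous in each control. -/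
structure IsControlSystem
    (f : EuclideanSpace ℝ (Fin n) → EuclideanSpace ℝ (Fin m) → EuclideanSpace ℝ (Fin p) →
      EuclideanSpace ℝ (Fin n))
    (U : Set (EuclideanSpace ℝ (Fin m))) (V : Set (EuclideanSpace ℝ (Fin p)))
    (C L : ℝ) : Prop where
  nonempty_left : U.Nonempty
  nonempty_right : V.Nonempty
  bound_nonneg : 0 ≤ C
  lip_nonneg : 0 ≤ L
  norm_le : ∀ x, ∀ u ∈ U, ∀ v ∈ V, ‖f x u v‖ ≤ C
  norm_sub_le : ∀ x x', ∀ u ∈ U, ∀ v ∈ V, ‖f x u v - f x' u v‖ ≤ L * ‖x - x'‖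
  continuousOn_left : ∀ x, ∀ v ∈ V, ContinuousOn (fun u => f x u v) U
  continuousOn_right : ∀ x, ∀ u ∈ U, ContinuousOn (fun v => f x u v) V

/-- An input agrees on `[t, T]` with an almost everywhere measurable map into the subtype `U`; off
`[t, T]` its own values need not lie in `U`. -/
lemma exists_aemeasurable_subtype {U : Set (EuclideanSpace ℝ (Fin k))} (hU : U.Nonempty)
    {u : ℝ → EuclideanSpace ℝ (Fin k)} (hu : u ∈ inputs U t T) :
    ∃ g : ℝ → U, AEMeasurable g (volume.restrict (Icc t T)) ∧
      ∀ s ∈ Icc t T, (g s : EuclideanSpace ℝ (Fin k)) = u s := by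
  classical
  obtain ⟨u₀, hu₀⟩ := hU
  set w : ℝ → EuclideanSpace ℝ (Fin k) := fun s => if s ∈ Icc t T then u s else u₀ with hw
  have hwU : ∀ s, w s ∈ U := by
    intro s
    by_cases hs : s ∈ Icc t T
    · simpa only [hw, if_pos hs] using hu.2 s hs
    · simpa only [hw, if_neg hs] using hu₀
  have hwm : AEMeasurable w (volume.restrict (Icc t T)) := by
    refine hu.1.congr ?_
    filter_upwards [ae_restrict_mem measurableSet_Icc] with s hs
    simp only [hw, if_pos hs]
  exact ⟨codRestrict w U hwU, hwm.subtype_mk, fun s hs => by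
    simp only [codRestrict, hw, if_pos hs]⟩

/-- A map that is continuous in each of its three arguments separately is Borel measurable, so the
velocity along a measurable curve with measurable inputs is measurable. -/
lemma IsControlSystem.aestronglyMeasurable (hf : IsControlSystem f U V C L)
    (hu : u ∈ inputs U t T) (hv : v ∈ inputs V t T)
    (hy : AEMeasurable y (volume.restrict (Icc t T))) :
    AEStronglyMeasurable (fun s => f (y s) (u s) (v s)) (volume.restrict (Icc t T)) := by
  obtain ⟨g, hg, hgu⟩ := exists_aemeasurable_subtype hf.nonempty_left hu
  obtain ⟨k, hk, hkv⟩ := exists_aemeasurable_subtype hf.nonempty_right hv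
  have h1 : ∀ x, Measurable (Function.uncurry fun (a : U) (b : V) => f x a b) := fun x =>
    measurable_uncurry_of_continuous_of_measurable
      (fun b => continuousOn_iff_continuous_domRestrict.1 (hf.continuousOn_left x b b.2))
      (fun a => (continuousOn_iff_continuous_domRestrict.1
        (hf.continuousOn_right x a a.2)).measurable)
  have h2 : Measurable (Function.uncurry fun x (c : U × V) => f x c.1 c.2) :=
    measurable_uncurry_of_continuous_of_measurable
      (fun c => (LipschitzWith.of_dist_le_mul (K := ⟨L, hf.lip_nonneg⟩) fun x x' => by
        rw [dist_eq_norm, dist_eq_norm]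
        exact hf.norm_sub_le x x' c.1 c.1.2 c.2 c.2.2).continuous)
      (fun x => h1 x)
  have h3 := (h2.comp_aemeasurable (hy.prodMk (hg.prodMk hk))).aestronglyMeasurable
  refine h3.congr ?_
  filter_upwards [ae_restrict_mem measurableSet_Icc] with s hs
  simp only [Function.comp, Function.uncurry, hgu s hs, hkv s hs]

lemma IsControlSystem.integrableOn (hf : IsControlSystem f U V C L)
    (hu : u ∈ inputs U t T) (hv : v ∈ inputs V t T)
    (hy : AEMeasurable y (volume.restrict (Icc t T))) :
    IntegrableOn (fun s => f (y s) (u s) (v s)) (Icc t T) := by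
  refine Integrable.of_bound (hf.aestronglyMeasurable hu hv hy) C ?_
  filter_upwards [ae_restrict_mem measurableSet_Icc] with s hs
  exact hf.norm_le _ _ (hu.2 s hs) _ (hv.2 s hs)

/-- With the weight `exp ((2 * L + 1) * s)`, integrating a velocity difference at most halves it.
This makes the Picard map a contraction, and gives a Grönwall bound. -/
lemma norm_integral_le_half_mul_exp {F : ℝ → EuclideanSpace ℝ (Fin n)} {M : ℝ} (hL : 0 ≤ L)
    (hM : 0 ≤ M) (ht : t ≤ t')
    (hF : ∀ s ∈ Icc t t', ‖F s‖ ≤ L * (M * Real.exp ((2 * L + 1) * s))) :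
    ‖∫ s in t..t', F s‖ ≤ M / 2 * Real.exp ((2 * L + 1) * t') := by
  have hK : 0 < 2 * L + 1 := by linarith
  have hc : Continuous fun s => L * (M * Real.exp ((2 * L + 1) * s)) := by fun_prop
  have hd : ∀ s ∈ uIcc t t', HasDerivAt
      (fun s => L * M / (2 * L + 1) * Real.exp ((2 * L + 1) * s))
      (L * (M * Real.exp ((2 * L + 1) * s))) s := by
    intro s _
    have := (((hasDerivAt_id s).const_mul (2 * L + 1)).exp).const_mul (L * M / (2 * L + 1))
    refine this.congr_deriv ?_
    simp only [id]
    field_simp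
  calc ‖∫ s in t..t', F s‖ ≤ ∫ s in t..t', L * (M * Real.exp ((2 * L + 1) * s)) :=
        intervalIntegral.norm_integral_le_of_norm_le ht
          (Filter.Eventually.of_forall fun s hs => hF s ⟨hs.1.le, hs.2⟩)
          (hc.intervalIntegrable _ _)
    _ = L * M / (2 * L + 1) * Real.exp ((2 * L + 1) * t') -
          L * M / (2 * L + 1) * Real.exp ((2 * L + 1) * t) :=
        intervalIntegral.integral_eq_sub_of_hasDerivAt hd (hc.intervalIntegrable _ _)
    _ ≤ L * M / (2 * L + 1) * Real.exp ((2 * L + 1) * t') := by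
        have : 0 ≤ L * M / (2 * L + 1) * Real.exp ((2 * L + 1) * t) := by positivity
        linarith
    _ ≤ M / 2 * Real.exp ((2 * L + 1) * t') := by
        refine mul_le_mul_of_nonneg_right ?_ (Real.exp_pos _).le
        rw [div_le_div_iff₀ hK two_pos]
        nlinarith

lemma IsTrajectory.continuousOn (ht : t ≤ T) (hy : IsTrajectory f t T x u v y) :
    ContinuousOn y (Icc t T) := by
  have h1 : ContinuousOn (fun τ => x + ∫ s in t..τ, f (y s) (u s) (v s)) (uIcc t T) :=
    continuousOn_const.add
      (intervalIntegral.continuousOn_primitive_interval' hy.1 left_mem_uIcc)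
  rw [uIcc_of_le ht] at h1
  exact h1.congr hy.2

lemma IsTrajectory.apply_left (ht : t ≤ T) (hy : IsTrajectory f t T x u v y) : y t = x := by
  simpa using hy.2 t ⟨le_rfl, ht⟩

lemma IsTrajectory.mono (ht : t ≤ t') (hT : t' ≤ T) (hy : IsTrajectory f t T x u v y) :
    IsTrajectory f t t' x u v y :=
  ⟨hy.1.mono_set (by
    rw [uIcc_of_le ht, uIcc_of_le (ht.trans hT)]; exact Icc_subset_Icc_right hT),
    fun τ hτ => hy.2 τ ⟨hτ.1, hτ.2.trans hT⟩⟩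

/-- The flow property: the tail of a trajectory is a trajectory. -/
lemma IsTrajectory.tail (ht : t ≤ t') (hT : t' ≤ T) (hy : IsTrajectory f t T x u v y) :
    IsTrajectory f t' T (y t') u v y := by
  have hsub : ∀ a b, a ∈ Icc t T → b ∈ Icc t T →
      IntervalIntegrable (fun s => f (y s) (u s) (v s)) volume a b := fun a b ha hb =>
    hy.1.mono_set (by rw [uIcc_of_le (ht.trans hT)]; exact ordConnected_Icc.uIcc_subset ha hb)
  have htT := ht.trans hT
  refine ⟨hsub _ _ ⟨ht, hT⟩ ⟨htT, le_rfl⟩, fun τ hτ => ?_⟩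
  rw [hy.2 τ ⟨ht.trans hτ.1, hτ.2⟩, hy.2 t' ⟨ht, hT⟩, add_assoc,
    intervalIntegral.integral_add_adjacent_intervals (hsub _ _ ⟨le_rfl, htT⟩ ⟨ht, hT⟩)
      (hsub _ _ ⟨ht, hT⟩ ⟨ht.trans hτ.1, hτ.2⟩)]

lemma IsTrajectory.congr (ht : t ≤ T)
    (hu : ∀ᵐ s ∂(volume.restrict (Icc t T)), u s = u' s)
    (hv : ∀ᵐ s ∂(volume.restrict (Icc t T)), v s = v' s) (hy : IsTrajectory f t T x u v y) :
    IsTrajectory f t T x u' v' y := by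
  have hae : ∀ᵐ s ∂volume, s ∈ Icc t T → f (y s) (u s) (v s) = f (y s) (u' s) (v' s) := by
    rw [← ae_restrict_iff' measurableSet_Icc]
    filter_upwards [hu, hv] with s h1 h2
    rw [h1, h2]
  refine ⟨hy.1.congr_ae ?_, fun τ hτ => ?_⟩
  · rw [Filter.EventuallyEq, ae_restrict_iff' measurableSet_uIoc]
    filter_upwards [hae] with s hs h
    rw [uIoc_of_le ht] at h
    exact hs (Ioc_subset_Icc_self h)
  · rw [hy.2 τ hτ]
    congr 1
    refine intervalIntegral.integral_congr_ae ?_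
    filter_upwards [hae] with s hs h
    rw [uIoc_of_le hτ.1] at h
    exact hs ⟨h.1.le, h.2.trans hτ.2⟩

/-- Trajectories move with speed at most `C`. -/
lemma IsTrajectory.norm_sub_le (hf : IsControlSystem f U V C L)
    (hu : u ∈ inputs U t T) (hv : v ∈ inputs V t T) (hy : IsTrajectory f t T x u v y)
    {τ : ℝ} (hτ : τ ∈ Icc t T) : ‖y τ - x‖ ≤ C * (τ - t) := by
  rw [hy.2 τ hτ, add_sub_cancel_left]
  have := intervalIntegral.norm_integral_le_of_norm_le_const (a := t) (b := τ) (C := C)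
    (f := fun s => f (y s) (u s) (v s)) (fun s hs => by
      rw [uIoc_of_le hτ.1] at hs
      have hs' : s ∈ Icc t T := ⟨hs.1.le, hs.2.trans hτ.2⟩
      exact hf.norm_le _ _ (hu.2 s hs') _ (hv.2 s hs'))
  rwa [abs_of_nonneg (sub_nonneg.2 hτ.1)] at this

/-- Lipschitz dependence on the starting point, by maximizing the weighted distance. -/
lemma IsTrajectory.dist_le (hf : IsControlSystem f U V C L) (ht : t ≤ T)
    (hu : u ∈ inputs U t T) (hv : v ∈ inputs V t T) (hy : IsTrajectory f t T x u v y)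
    (hy' : IsTrajectory f t T x' u v y') {τ : ℝ} (hτ : τ ∈ Icc t T) :
    ‖y τ - y' τ‖ ≤ 2 * Real.exp ((2 * L + 1) * (τ - t)) * ‖x - x'‖ := by
  set K := 2 * L + 1 with hK
  have hK0 : 0 < K := by have := hf.lip_nonneg; linarith
  have hcont : ContinuousOn (fun s => ‖y s - y' s‖ * Real.exp (-(K * s))) (Icc t T) :=
    ((hy.continuousOn ht).sub (hy'.continuousOn ht)).norm.mul (by fun_prop)
  obtain ⟨σ, hσ, hmax⟩ := isCompact_Icc.exists_isMaxOn (nonempty_Icc.2 ht) hcont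
  set M := ‖y σ - y' σ‖ * Real.exp (-(K * σ)) with hM
  have hM0 : 0 ≤ M := by positivity
  have hle : ∀ s ∈ Icc t T, ‖y s - y' s‖ ≤ M * Real.exp (K * s) := by
    intro s hs
    have h1 : ‖y s - y' s‖ * Real.exp (-(K * s)) ≤ M := hmax hs
    rwa [Real.exp_neg, ← div_eq_mul_inv, div_le_iff₀ (Real.exp_pos _)] at h1
  have hint : ∀ {z w}, IsTrajectory f t T w u v z →
      IntervalIntegrable (fun s => f (z s) (u s) (v s)) volume t σ := fun hz =>
    hz.1.mono_set (by rw [uIcc_of_le hσ.1, uIcc_of_le ht]; exact Icc_subset_Icc_right hσ.2)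
  have hσle : ‖y σ - y' σ‖ ≤ ‖x - x'‖ + M / 2 * Real.exp (K * σ) := by
    have heq : y σ - y' σ = (x - x') +
        ∫ s in t..σ, (f (y s) (u s) (v s) - f (y' s) (u s) (v s)) := by
      rw [intervalIntegral.integral_sub (hint hy) (hint hy'), hy.2 σ hσ, hy'.2 σ hσ]
      abel
    rw [heq]
    refine (norm_add_le _ _).trans (add_le_add_right ?_ _)
    refine norm_integral_le_half_mul_exp hf.lip_nonneg hM0 hσ.1 fun s hs => ?_
    have hs' : s ∈ Icc t T := ⟨hs.1, hs.2.trans hσ.2⟩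
    exact (hf.norm_sub_le _ _ _ (hu.2 s hs') _ (hv.2 s hs')).trans
      (mul_le_mul_of_nonneg_left (hle s hs') hf.lip_nonneg)
  have hMexp : M * Real.exp (K * σ) = ‖y σ - y' σ‖ := by
    rw [hM, mul_assoc, ← Real.exp_add]; simp
  have hM2 : M ≤ 2 * ‖x - x'‖ * Real.exp (-(K * t)) := by
    have h1 : M * Real.exp (K * σ) ≤ 2 * ‖x - x'‖ := by linarith
    have h2 : M * Real.exp (K * t) ≤ 2 * ‖x - x'‖ :=
      le_trans (mul_le_mul_of_nonneg_left
        (Real.exp_le_exp.2 (mul_le_mul_of_nonneg_left hσ.1 hK0.le)) hM0) h1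
    rwa [Real.exp_neg, ← div_eq_mul_inv, le_div_iff₀ (Real.exp_pos _)]
  calc ‖y τ - y' τ‖ ≤ M * Real.exp (K * τ) := hle τ hτ
    _ ≤ 2 * ‖x - x'‖ * Real.exp (-(K * t)) * Real.exp (K * τ) := by gcongr
    _ = 2 * Real.exp (K * (τ - t)) * ‖x - x'‖ := by
        rw [mul_assoc, ← Real.exp_add, show -(K * t) + K * τ = K * (τ - t) by ring]; ring

lemma IsTrajectory.eqOn (hf : IsControlSystem f U V C L) (ht : t ≤ T)
    (hu : u ∈ inputs U t T) (hv : v ∈ inputs V t T) (hy : IsTrajectory f t T x u v y)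
    (hy' : IsTrajectory f t T x u v y') : EqOn y y' (Icc t T) := by
  intro τ hτ
  have := hy.dist_le hf ht hu hv hy' hτ
  rw [sub_self, norm_zero, mul_zero] at this
  exact sub_eq_zero.1 (norm_le_zero_iff.1 this)

/-- Existence by Banach's fixed point theorem, for the Picard map conjugated with the weight
`exp ((2 * L + 1) * s)`. -/
lemma exists_isTrajectory (hf : IsControlSystem f U V C L) (ht : t ≤ T)
    (hu : u ∈ inputs U t T) (hv : v ∈ inputs V t T) (x : EuclideanSpace ℝ (Fin n)) :
    ∃ y, IsTrajectory f t T x u v y := by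
  set K := 2 * L + 1 with hK
  let e : ℝ → ℝ := fun s => Real.exp (K * s)
  have he : Continuous e := by fun_prop
  let Y : C(Icc t T, EuclideanSpace ℝ (Fin n)) → ℝ → EuclideanSpace ℝ (Fin n) :=
    fun z s => e s • IccExtend ht z s
  have hY : ∀ z, Continuous (Y z) := fun z => he.smul z.continuous.Icc_extend'
  have hI : ∀ z, IntervalIntegrable (fun s => f (Y z s) (u s) (v s)) volume t T := fun z =>
    (intervalIntegrable_iff_integrableOn_Icc_of_le ht).2
      (hf.integrableOn hu hv (hY z).measurable.aemeasurable)
  have hI' : ∀ z, ∀ τ ∈ Icc t T,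
      IntervalIntegrable (fun s => f (Y z s) (u s) (v s)) volume t τ := fun z τ hτ =>
    (hI z).mono_set (by rw [uIcc_of_le hτ.1, uIcc_of_le ht]; exact Icc_subset_Icc_right hτ.2)
  have hP : ∀ z, Continuous fun τ : Icc t T =>
      (e τ)⁻¹ • (x + ∫ s in t..τ, f (Y z s) (u s) (v s)) := by
    intro z
    have h1 := intervalIntegral.continuousOn_primitive_interval' (hI z) left_mem_uIcc
    rw [uIcc_of_le ht] at h1
    exact ((he.comp continuous_subtype_val).inv₀ fun _ => (Real.exp_pos _).ne').smul
      (continuous_const.add (continuousOn_iff_continuous_domRestrict.1 h1))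
  let Φ : C(Icc t T, EuclideanSpace ℝ (Fin n)) → C(Icc t T, EuclideanSpace ℝ (Fin n)) :=
    fun z => ⟨_, hP z⟩
  have hΦ : ContractingWith (1 / 2) Φ := by
    refine ⟨by norm_num [← NNReal.coe_lt_coe], LipschitzWith.of_dist_le_mul fun z w => ?_⟩
    rw [ContinuousMap.dist_le (by positivity)]
    intro τ
    have hYd : ∀ s, ‖Y z s - Y w s‖ ≤ dist z w * e s := by
      intro s
      rw [← smul_sub, norm_smul, Real.norm_of_nonneg (Real.exp_pos _).le, mul_comm]
      refine mul_le_mul_of_nonneg_right ?_ (Real.exp_pos _).le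
      rw [← dist_eq_norm]
      exact ContinuousMap.dist_apply_le_dist _
    have h1 : ‖∫ s in t..τ, (f (Y z s) (u s) (v s) - f (Y w s) (u s) (v s))‖ ≤
        dist z w / 2 * e τ :=
      norm_integral_le_half_mul_exp hf.lip_nonneg dist_nonneg τ.2.1 fun s hs => by
        have hs' : s ∈ Icc t T := ⟨hs.1, hs.2.trans τ.2.2⟩
        exact (hf.norm_sub_le _ _ _ (hu.2 s hs') _ (hv.2 s hs')).trans
          (mul_le_mul_of_nonneg_left (hYd s) hf.lip_nonneg)
    have h2 : Φ z τ - Φ w τ =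
        (e τ)⁻¹ • ∫ s in t..τ, (f (Y z s) (u s) (v s) - f (Y w s) (u s) (v s)) := by
      rw [intervalIntegral.integral_sub (hI' z τ τ.2) (hI' w τ τ.2)]
      simp only [Φ, ContinuousMap.coe_mk, ← smul_sub, add_sub_add_left_eq_sub]
    have h3 : 0 < e τ := Real.exp_pos _
    rw [dist_eq_norm, h2, norm_smul, norm_inv, Real.norm_of_nonneg h3.le,
      inv_mul_le_iff₀ h3]
    calc _ ≤ dist z w / 2 * e τ := h1
      _ = _ := by push_cast; ring
  let z := ContractingWith.fixedPoint Φ hΦ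
  have hz : Φ z = z := hΦ.fixedPoint_isFixedPt
  refine ⟨Y z, hI z, fun τ hτ => ?_⟩
  have h1 : (e τ)⁻¹ • (x + ∫ s in t..τ, f (Y z s) (u s) (v s)) = z ⟨τ, hτ⟩ :=
    DFunLike.congr_fun hz ⟨τ, hτ⟩
  have h2 : Y z τ = e τ • z ⟨τ, hτ⟩ := by simp only [Y, IccExtend_of_mem ht z hτ]
  rw [h2, ← h1, smul_inv_smul₀ (Real.exp_pos _).ne']

lemma isTrajectory_trajectory (hf : IsControlSystem f U V C L) (ht : t ≤ T)
    (hu : u ∈ inputs U t T) (hv : v ∈ inputs V t T) (x : EuclideanSpace ℝ (Fin n)) :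
    IsTrajectory f t T x u v (trajectory f t T x u v) :=
  Classical.epsilon_spec (exists_isTrajectory hf ht hu hv x)

/-! ### Strategies that secure a level -/

/-- The real function `g` is bounded by `B` and `K`-Lipschitz. -/
structure IsBoundedLipschitz (g : EuclideanSpace ℝ (Fin n) → ℝ) (B K : ℝ) : Prop where
  abs_le : ∀ x, |g x| ≤ B
  const_nonneg : 0 ≤ K
  abs_sub_le : ∀ x x', |g x - g x'| ≤ K * ‖x - x'‖

lemma IsBoundedLipschitz.le_add (hh : IsBoundedLipschitz h B K)
    (x x' : EuclideanSpace ℝ (Fin n)) : h x ≤ h x' + K * ‖x - x'‖ := by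
  linarith [(_root_.abs_le.1 (hh.abs_sub_le x x')).2]

/-- Against every disturbance, the strategy `γ` keeps the payoff from `(x, t)` at most `a`. -/
def Secures
    (f : EuclideanSpace ℝ (Fin n) → EuclideanSpace ℝ (Fin m) → EuclideanSpace ℝ (Fin p) →
      EuclideanSpace ℝ (Fin n))
    (l h : EuclideanSpace ℝ (Fin n) → ℝ) (t T : ℝ) (x : EuclideanSpace ℝ (Fin n)) (a : ℝ)
    (γ : inputs V t T → inputs U t T) : Prop :=
  ∀ (v : inputs V t T) (y : ℝ → EuclideanSpace ℝ (Fin n)),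
    IsTrajectory f t T x (γ v).1 v.1 y → l (y T) ≤ a ∧ ∀ τ ∈ Icc t T, h (y τ) ≤ a

lemma payoff_le_iff (ht : t ≤ T) (hh : IsBoundedLipschitz h B K) :
    payoff l h t T y ≤ a ↔ l (y T) ≤ a ∧ ∀ τ ∈ Icc t T, h (y τ) ≤ a := by
  have hbdd : BddAbove ((fun τ => h (y τ)) '' Icc t T) :=
    ⟨B, by rintro _ ⟨τ, _, rfl⟩; exact (abs_le.1 (hh.abs_le _)).2⟩
  rw [payoff, max_le_iff, csSup_le_iff hbdd ((nonempty_Icc.2 ht).image _), forall_mem_image]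

lemma const_mem_inputs {U : Set (EuclideanSpace ℝ (Fin k))} {a : EuclideanSpace ℝ (Fin k)}
    (ha : a ∈ U) : (fun _ : ℝ => a) ∈ inputs U t T :=
  ⟨aemeasurable_const, fun _ _ => ha⟩

lemma IsControlSystem.nonempty_inputs (hf : IsControlSystem f U V C L) :
    Nonempty (inputs V t T) :=
  hf.nonempty_right.elim fun _ hb => ⟨⟨_, const_mem_inputs hb⟩⟩

lemma IsControlSystem.nonempty_strategies (hf : IsControlSystem f U V C L) :
    Nonempty (strategies U V t T) :=
  hf.nonempty_left.elim fun _ ha => ⟨⟨fun _ => ⟨_, const_mem_inputs ha⟩,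
    fun _ _ _ _ _ => Filter.Eventually.of_forall fun _ => rfl⟩⟩

lemma abs_payoff_le (ht : t ≤ T) (hl : IsBoundedLipschitz l B K)
    (hh : IsBoundedLipschitz h B K) : |payoff l h t T y| ≤ B :=
  abs_le.2 ⟨(abs_le.1 (hl.abs_le _)).1.trans (le_max_left _ _),
    (payoff_le_iff ht hh).2 ⟨(abs_le.1 (hl.abs_le _)).2, fun _ _ => (abs_le.1 (hh.abs_le _)).2⟩⟩

lemma bddAbove_range_payoff (ht : t ≤ T) (hl : IsBoundedLipschitz l B K)
    (hh : IsBoundedLipschitz h B K) {ι : Sort*} (y : ι → ℝ → EuclideanSpace ℝ (Fin n)) :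
    BddAbove (range fun i => payoff l h t T (y i)) :=
  ⟨B, by rintro _ ⟨i, rfl⟩; exact (abs_le.1 (abs_payoff_le ht hl hh)).2⟩

lemma value_le (hf : IsControlSystem f U V C L) (hl : IsBoundedLipschitz l B K)
    (hh : IsBoundedLipschitz h B K) (ht : t ≤ T) (γ : strategies U V t T)
    (hγ : Secures f l h t T x a γ.1) : value f l h U V T (x, t) ≤ a := by
  obtain ⟨v₀⟩ : Nonempty (inputs V t T) := hf.nonempty_inputs
  have : Nonempty (inputs V t T) := ⟨v₀⟩
  refine (ciInf_le ⟨-B, ?_⟩ γ).trans (ciSup_le fun v => (payoff_le_iff ht hh).2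
    (hγ v _ (isTrajectory_trajectory hf ht (γ.1 v).2 v.2 x)))
  rintro _ ⟨γ', rfl⟩
  exact (abs_le.1 (abs_payoff_le ht hl hh)).1.trans
    (le_ciSup (bddAbove_range_payoff ht hl hh _) v₀)

lemma exists_secures (hf : IsControlSystem f U V C L) (hl : IsBoundedLipschitz l B K)
    (hh : IsBoundedLipschitz h B K) (ht : t ≤ T) (ha : value f l h U V T (x, t) < a) :
    ∃ γ : strategies U V t T, Secures f l h t T x a γ.1 := by
  have : Nonempty (strategies U V t T) := hf.nonempty_strategies
  obtain ⟨γ, hγ⟩ := exists_lt_of_ciInf_lt ha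
  refine ⟨γ, fun v y hy => ?_⟩
  have h1 := (payoff_le_iff ht hh).1
    ((le_ciSup (bddAbove_range_payoff ht hl hh _) v).trans hγ.le)
  have h2 : EqOn y (trajectory f t T x (γ.1 v).1 v.1) (Icc t T) :=
    hy.eqOn hf ht (γ.1 v).2 v.2 (isTrajectory_trajectory hf ht (γ.1 v).2 v.2 x)
  exact ⟨h2 ⟨ht, le_rfl⟩ ▸ h1.1, fun τ hτ => h2 hτ ▸ h1.2 τ hτ⟩

lemma obstacle_le_value (hf : IsControlSystem f U V C L) (hl : IsBoundedLipschitz l B K)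
    (hh : IsBoundedLipschitz h B K) (ht : t ≤ T) : h x ≤ value f l h U V T (x, t) := by
  refine le_of_forall_gt_imp_ge_of_dense fun a ha => ?_
  obtain ⟨γ, hγ⟩ := exists_secures hf hl hh ht ha
  obtain ⟨v⟩ : Nonempty (inputs V t T) := hf.nonempty_inputs
  have hy := isTrajectory_trajectory hf ht (γ.1 v).2 v.2 x
  simpa only [hy.apply_left ht] using (hγ v _ hy).2 t ⟨le_rfl, ht⟩

lemma value_terminal (hf : IsControlSystem f U V C L) (hl : IsBoundedLipschitz l B K)
    (hh : IsBoundedLipschitz h B K) : value f l h U V T (x, T) = max (l x) (h x) := by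
  apply le_antisymm
  · obtain ⟨γ⟩ : Nonempty (strategies U V T T) := hf.nonempty_strategies
    refine value_le hf hl hh le_rfl γ fun v y hy => ?_
    have hx := hy.apply_left le_rfl
    refine ⟨hx ▸ le_max_left _ _, fun τ hτ => ?_⟩
    rw [Icc_self, mem_singleton_iff] at hτ
    rw [hτ, hx]
    exact le_max_right _ _
  · refine max_le (le_of_forall_gt_imp_ge_of_dense fun a ha => ?_)
      (obstacle_le_value hf hl hh le_rfl)
    obtain ⟨γ, hγ⟩ := exists_secures hf hl hh le_rfl ha
    obtain ⟨v⟩ : Nonempty (inputs V T T) := hf.nonempty_inputs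
    have hy := isTrajectory_trajectory hf le_rfl (γ.1 v).2 v.2 x
    simpa only [hy.apply_left le_rfl] using (hγ v _ hy).1

/-! ### The dynamic programming principle -/

/-- The input that is `a` before time `t'` and `b` from then on. -/
noncomputable def glue (t' : ℝ) (a b : ℝ → EuclideanSpace ℝ (Fin k)) :
    ℝ → EuclideanSpace ℝ (Fin k) :=
  (Iio t').piecewise a b

section glue

variable {U : Set (EuclideanSpace ℝ (Fin k))} {a b : ℝ → EuclideanSpace ℝ (Fin k)}

lemma glue_of_lt (hs : s < t') : glue t' a b s = a s := piecewise_eq_of_mem _ _ _ hs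

lemma glue_of_le (hs : t' ≤ s) : glue t' a b s = b s :=
  piecewise_eq_of_notMem _ _ _ (notMem_Iio.2 hs)

lemma glue_ae_eq_left (t t' : ℝ) (a b : ℝ → EuclideanSpace ℝ (Fin k)) :
    ∀ᵐ s ∂(volume.restrict (Icc t t')), glue t' a b s = a s := by
  rw [← restrict_Ico_eq_restrict_Icc]
  filter_upwards [ae_restrict_mem measurableSet_Ico] with s hs using glue_of_lt hs.2

lemma glue_ae_eq_right (t' T : ℝ) (a b : ℝ → EuclideanSpace ℝ (Fin k)) :
    ∀ᵐ s ∂(volume.restrict (Icc t' T)), glue t' a b s = b s := by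
  filter_upwards [ae_restrict_mem measurableSet_Icc] with s hs using glue_of_le hs.1

lemma glue_mem_inputs (ha : a ∈ inputs U t T) (hb : b ∈ inputs U t' T) :
    glue t' a b ∈ inputs U t T := by
  constructor
  · have hunion : Icc t T = (Icc t T ∩ Iio t') ∪ (Icc t T ∩ Ici t') := by
      rw [← inter_union_distrib_left, Iio_union_Ici, inter_univ]
    rw [hunion, aemeasurable_union_iff]
    constructor
    · refine (ha.1.mono_measure (Measure.restrict_mono inter_subset_left le_rfl)).congr ?_
      filter_upwards [ae_restrict_mem (measurableSet_Icc.inter measurableSet_Iio)] with s hs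
      exact (glue_of_lt hs.2).symm
    · refine (hb.1.mono_measure (Measure.restrict_mono (fun s hs => ?_) le_rfl)).congr ?_
      · exact ⟨hs.2, hs.1.2⟩
      · filter_upwards [ae_restrict_mem (measurableSet_Icc.inter measurableSet_Ici)] with s hs
        exact (glue_of_le hs.2).symm
  · intro s hs
    rcases lt_or_ge s t' with h1 | h1
    · rw [glue_of_lt h1]; exact ha.2 s hs
    · rw [glue_of_le h1]; exact hb.2 s ⟨h1, hs.2⟩

lemma inputs_tail (ht : t ≤ t') (ha : a ∈ inputs U t T) : a ∈ inputs U t' T :=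
  ⟨ha.1.mono_measure (Measure.restrict_mono (Icc_subset_Icc_left ht) le_rfl),
    fun s hs => ha.2 s ⟨ht.trans hs.1, hs.2⟩⟩

lemma inputs_mono (hT : t' ≤ T) (ha : a ∈ inputs U t T) : a ∈ inputs U t t' :=
  ⟨ha.1.mono_measure (Measure.restrict_mono (Icc_subset_Icc_right hT) le_rfl),
    fun s hs => ha.2 s ⟨hs.1, hs.2.trans hT⟩⟩

/-- Two inputs agree almost everywhere on `[t, s]` when they do so before and after `t'`. -/
lemma ae_eq_of_ae_eq_of_ae_eq {c d : ℝ → EuclideanSpace ℝ (Fin k)}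
    (h1 : ∀ᵐ τ ∂(volume.restrict (Icc t t')), c τ = d τ)
    (h2 : ∀ᵐ τ ∂(volume.restrict (Icc t' s)), c τ = d τ) :
    ∀ᵐ τ ∂(volume.restrict (Icc t s)), c τ = d τ := by
  rw [ae_restrict_iff' measurableSet_Icc] at *
  filter_upwards [h1, h2] with τ h1 h2 hτ
  rcases le_total τ t' with h | h
  · exact h1 ⟨hτ.1, h⟩
  · exact h2 ⟨h, hτ.2⟩

lemma ae_eq_mono {c d : ℝ → EuclideanSpace ℝ (Fin k)} {r r' s s' : ℝ} (hr : r ≤ r')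
    (hs : s' ≤ s) (h1 : ∀ᵐ τ ∂(volume.restrict (Icc r s)), c τ = d τ) :
    ∀ᵐ τ ∂(volume.restrict (Icc r' s')), c τ = d τ :=
  ae_restrict_of_ae_restrict_of_subset (Icc_subset_Icc hr hs) h1

end glue

/-- Trajectories depend on the past of the inputs only, and on these up to null sets. -/
lemma IsTrajectory.eqOn_of_ae_eq (hf : IsControlSystem f U V C L) (ht : t ≤ t') (hT : t' ≤ T)
    (hu : u ∈ inputs U t T) (hv : v ∈ inputs V t T)
    (huu : ∀ᵐ s ∂(volume.restrict (Icc t t')), u' s = u s)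
    (hvv : ∀ᵐ s ∂(volume.restrict (Icc t t')), v' s = v s)
    (hy : IsTrajectory f t T x u v y) (hy' : IsTrajectory f t T x u' v' y') :
    EqOn y' y (Icc t t') :=
  ((hy'.mono ht hT).congr ht huu hvv).eqOn hf ht (inputs_mono hT hu) (inputs_mono hT hv)
    (hy.mono ht hT)

/-- Upper half of the dynamic programming principle: play `γ₀` up to time `t'`, then a strategy
that is good for the state reached. The strategy for the rest is chosen separately for each state;
no measurability in the state is needed, because a strategy acts on whole disturbances. -/
lemma value_le_of_value_lt (hf : IsControlSystem f U V C L) (hl : IsBoundedLipschitz l B K)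
    (hh : IsBoundedLipschitz h B K) (ht : t ≤ t') (hT : t' ≤ T) (γ₀ : strategies U V t T)
    (H : ∀ (v : inputs V t T) (y : ℝ → EuclideanSpace ℝ (Fin n)),
      IsTrajectory f t T x (γ₀.1 v).1 v.1 y →
        (∀ τ ∈ Icc t t', h (y τ) ≤ a) ∧ value f l h U V T (y t', t') < a) :
    value f l h U V T (x, t) ≤ a := by
  have hσ : ∀ z, ∃ γ : strategies U V t' T, value f l h U V T (z, t') < a →
      Secures f l h t' T z a γ.1 := by
    intro z
    by_cases hz : value f l h U V T (z, t') < a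
    · obtain ⟨γ, hγ⟩ := exists_secures hf hl hh hT hz
      exact ⟨γ, fun _ => hγ⟩
    · exact ⟨hf.nonempty_strategies.some, fun h' => absurd h' hz⟩
  choose σ hσ using hσ
  have htT := ht.trans hT
  let φ : inputs V t T → ℝ → EuclideanSpace ℝ (Fin n) := fun v =>
    trajectory f t T x (γ₀.1 v).1 v.1
  have hφ : ∀ v, IsTrajectory f t T x (γ₀.1 v).1 v.1 (φ v) := fun v =>
    isTrajectory_trajectory hf htT (γ₀.1 v).2 v.2 x
  let tl : inputs V t T → inputs V t' T := fun v => ⟨v.1, inputs_tail ht v.2⟩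
  let γ : inputs V t T → inputs U t T := fun v =>
    ⟨glue t' (γ₀.1 v).1 ((σ (φ v t')).1 (tl v)).1,
      glue_mem_inputs (γ₀.1 v).2 ((σ (φ v t')).1 (tl v)).2⟩
  have hγ : IsNonanticipative γ := by
    intro s hs v v' hvv
    have h0 := γ₀.2 s hs v v' hvv
    rcases lt_or_ge s t' with hst | hst
    · filter_upwards [h0, ae_restrict_mem measurableSet_Icc] with τ h1 hτ
      simp only [γ, glue_of_lt (hτ.2.trans_lt hst), h1]
    · have hφt : φ v t' = φ v' t' := (hφ v').eqOn_of_ae_eq hf ht hT (γ₀.1 v').2 v'.2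
        (ae_eq_mono le_rfl hst h0) (ae_eq_mono le_rfl hst hvv) (hφ v) ⟨ht, le_rfl⟩
      have h2 := (σ (φ v' t')).2 s ⟨hst, hs.2⟩ (tl v) (tl v') (ae_eq_mono ht le_rfl hvv)
      refine ae_eq_of_ae_eq_of_ae_eq (t' := t') ?_ ?_
      · filter_upwards [glue_ae_eq_left t t' (γ₀.1 v).1 ((σ (φ v t')).1 (tl v)).1,
          glue_ae_eq_left t t' (γ₀.1 v').1 ((σ (φ v' t')).1 (tl v')).1,
          ae_eq_mono le_rfl hst h0] with τ h1 h3 h4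
        simp only [γ, h1, h3, h4]
      · filter_upwards [h2, ae_restrict_mem measurableSet_Icc] with τ h1 hτ
        simp only [γ, glue_of_le hτ.1, hφt, h1]
  refine value_le hf hl hh htT ⟨γ, hγ⟩ fun v y hy => ?_
  have hyφ : EqOn y (φ v) (Icc t t') :=
    (hφ v).eqOn_of_ae_eq hf ht hT (γ₀.1 v).2 v.2 (glue_ae_eq_left _ _ _ _)
      (Filter.Eventually.of_forall fun _ => rfl) hy
  obtain ⟨h1, h2⟩ := H v (φ v) (hφ v)
  have h3 : IsTrajectory f t' T (φ v t') ((σ (φ v t')).1 (tl v)).1 (tl v).1 y := by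
    have := hy.tail ht hT
    rw [hyφ ⟨ht, le_rfl⟩] at this
    exact this.congr hT (glue_ae_eq_right _ _ _ _) (Filter.Eventually.of_forall fun _ => rfl)
  obtain ⟨h4, h5⟩ := hσ _ h2 (tl v) y h3
  refine ⟨h4, fun τ hτ => ?_⟩
  rcases le_total τ t' with hτt | hτt
  · rw [hyφ ⟨hτ.1, hτt⟩]; exact h1 τ ⟨hτ.1, hτt⟩
  · exact h5 τ ⟨hτt, hτ.2⟩

/-- Lower half of the dynamic programming principle: a strategy that secures `a` from `(x, t)`,
continued after a fixed disturbance on `[t, t']`, secures `a` from the state reached at `t'`. -/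
lemma Secures.value_le (hf : IsControlSystem f U V C L) (hl : IsBoundedLipschitz l B K)
    (hh : IsBoundedLipschitz h B K) (ht : t ≤ t') (hT : t' ≤ T) {γ : strategies U V t T}
    (hγ : Secures f l h t T x a γ.1) (v : inputs V t T)
    (hy : IsTrajectory f t T x (γ.1 v).1 v.1 y) : value f l h U V T (y t', t') ≤ a := by
  have htT := ht.trans hT
  let g : inputs V t' T → inputs V t T := fun w => ⟨glue t' v.1 w.1, glue_mem_inputs v.2 w.2⟩
  let γ' : inputs V t' T → inputs U t' T := fun w => ⟨(γ.1 (g w)).1, inputs_tail ht (γ.1 (g w)).2⟩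
  have hγ' : IsNonanticipative γ' := by
    intro s hs w w' hww
    refine ae_eq_mono ht le_rfl (γ.2 s ⟨ht.trans hs.1, hs.2⟩ (g w) (g w') ?_)
    refine ae_eq_of_ae_eq_of_ae_eq (t' := t') ?_ ?_
    · filter_upwards [glue_ae_eq_left t t' v.1 w.1, glue_ae_eq_left t t' v.1 w'.1] with τ h1 h2
      simp only [g, h1, h2]
    · filter_upwards [hww, ae_restrict_mem measurableSet_Icc] with τ h1 hτ
      simp only [g, glue_of_le hτ.1, h1]
  refine ReachAvoid.value_le hf hl hh hT ⟨γ', hγ'⟩ fun w z hz => ?_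
  have hφ := isTrajectory_trajectory hf htT (γ.1 (g w)).2 (g w).2 x
  set φ := trajectory f t T x (γ.1 (g w)).1 (g w).1
  have hφy : φ t' = y t' := hy.eqOn_of_ae_eq hf ht hT (γ.1 v).2 v.2
    (γ.2 t' ⟨ht, hT⟩ (g w) v (glue_ae_eq_left _ _ _ _)) (glue_ae_eq_left _ _ _ _) hφ ⟨ht, le_rfl⟩
  have hφz : EqOn z φ (Icc t' T) := by
    have h1 := hφ.tail ht hT
    rw [hφy] at h1
    exact hz.eqOn hf hT (γ' w).2 w.2 (h1.congr hT (Filter.Eventually.of_forall fun _ => rfl)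
      (glue_ae_eq_right _ _ _ _))
  obtain ⟨h1, h2⟩ := hγ (g w) φ hφ
  exact ⟨hφz ⟨hT, le_rfl⟩ ▸ h1, fun τ hτ => hφz hτ ▸ h2 τ ⟨ht.trans hτ.1, hτ.2⟩⟩

/-! ### Lipschitz continuity of the value function -/

/-- A Lipschitz constant of the value function in the state. -/
noncomputable def stateLip (K L T : ℝ) : ℝ := K * (2 * Real.exp ((2 * L + 1) * T))

lemma stateLip_nonneg (hK : 0 ≤ K) : 0 ≤ stateLip K L T := by unfold stateLip; positivity

lemma value_le_add_state (hf : IsControlSystem f U V C L) (hl : IsBoundedLipschitz l B K)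
    (hh : IsBoundedLipschitz h B K) (ht0 : 0 ≤ t) (ht : t ≤ T)
    (x x' : EuclideanSpace ℝ (Fin n)) :
    value f l h U V T (x', t) ≤ value f l h U V T (x, t) + stateLip K L T * ‖x - x'‖ := by
  rw [← sub_le_iff_le_add]
  refine le_of_forall_gt_imp_ge_of_dense fun a ha => ?_
  obtain ⟨γ, hγ⟩ := exists_secures hf hl hh ht ha
  rw [sub_le_iff_le_add]
  refine value_le hf hl hh ht γ fun v y hy => ?_
  have hφ := isTrajectory_trajectory hf ht (γ.1 v).2 v.2 x
  set φ := trajectory f t T x (γ.1 v).1 v.1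
  have hdist : ∀ τ ∈ Icc t T, K * ‖y τ - φ τ‖ ≤ stateLip K L T * ‖x - x'‖ := by
    intro τ hτ
    rw [stateLip, mul_assoc]
    refine mul_le_mul_of_nonneg_left ?_ hl.const_nonneg
    rw [norm_sub_rev]
    refine (hφ.dist_le hf ht (γ.1 v).2 v.2 hy hτ).trans ?_
    have := hf.lip_nonneg
    gcongr
    linarith [hτ.2]
  obtain ⟨h1, h2⟩ := hγ v φ hφ
  exact ⟨by linarith [hl.le_add (y T) (φ T), hdist T ⟨ht, le_rfl⟩],
    fun τ hτ => by linarith [hh.le_add (y τ) (φ τ), hdist τ hτ, h2 τ hτ]⟩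

lemma value_le_add_time (hf : IsControlSystem f U V C L) (hl : IsBoundedLipschitz l B K)
    (hh : IsBoundedLipschitz h B K) (ht0 : 0 ≤ t) (ht : t ≤ t') (hT : t' ≤ T) :
    value f l h U V T (x, t) ≤
      value f l h U V T (x, t') + (stateLip K L T + K) * (C * (t' - t)) := by
  have htT := ht.trans hT
  have hS : 0 ≤ stateLip K L T := stateLip_nonneg hl.const_nonneg
  have hK := hl.const_nonneg
  refine le_of_forall_pos_le_add fun ε hε => ?_
  obtain ⟨γ⟩ : Nonempty (strategies U V t T) := hf.nonempty_strategies
  refine value_le_of_value_lt hf hl hh ht hT γ fun v y hy => ?_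
  have hd : ∀ τ ∈ Icc t t', ‖y τ - x‖ ≤ C * (t' - t) := fun τ hτ =>
    (hy.norm_sub_le hf (γ.1 v).2 v.2 ⟨hτ.1, hτ.2.trans hT⟩).trans
      (mul_le_mul_of_nonneg_left (by linarith [hτ.2]) hf.bound_nonneg)
  have hCt : 0 ≤ C * (t' - t) := mul_nonneg hf.bound_nonneg (sub_nonneg.2 ht)
  constructor
  · intro τ hτ
    nlinarith [hh.le_add (y τ) x, mul_le_mul_of_nonneg_left (hd τ hτ) hK,
      obstacle_le_value (x := x) hf hl hh hT, mul_nonneg hS hCt]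
  · have h1 := value_le_add_state hf hl hh (ht0.trans ht) hT x (y t')
    rw [norm_sub_rev] at h1
    nlinarith [mul_le_mul_of_nonneg_left (hd t' ⟨ht, le_rfl⟩) hS, mul_nonneg hK hCt]

lemma value_ge_sub_time (hf : IsControlSystem f U V C L) (hl : IsBoundedLipschitz l B K)
    (hh : IsBoundedLipschitz h B K) (ht0 : 0 ≤ t) (ht : t ≤ t') (hT : t' ≤ T) :
    value f l h U V T (x, t') ≤
      value f l h U V T (x, t) + (stateLip K L T + K) * (C * (t' - t)) := by
  have htT := ht.trans hT
  have hS : 0 ≤ stateLip K L T := stateLip_nonneg hl.const_nonneg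
  have hCt : 0 ≤ C * (t' - t) := mul_nonneg hf.bound_nonneg (sub_nonneg.2 ht)
  rw [← sub_le_iff_le_add]
  refine le_of_forall_gt_imp_ge_of_dense fun a ha => ?_
  obtain ⟨γ, hγ⟩ := exists_secures hf hl hh htT ha
  obtain ⟨v⟩ : Nonempty (inputs V t T) := hf.nonempty_inputs
  have hφ := isTrajectory_trajectory hf htT (γ.1 v).2 v.2 x
  set φ := trajectory f t T x (γ.1 v).1 v.1
  have h1 := hγ.value_le hf hl hh ht hT v hφ
  have h2 := value_le_add_state hf hl hh (ht0.trans ht) hT (φ t') x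
  have h3 := hφ.norm_sub_le hf (γ.1 v).2 v.2 ⟨ht, hT⟩
  nlinarith [mul_le_mul_of_nonneg_left h3 hS, mul_nonneg hl.const_nonneg hCt]

lemma continuousOn_value (hf : IsControlSystem f U V C L) (hl : IsBoundedLipschitz l B K)
    (hh : IsBoundedLipschitz h B K) :
    ContinuousOn (value f l h U V T) (univ ×ˢ Icc 0 T) := by
  set S := stateLip K L T with hSdef
  have hS : 0 ≤ S := stateLip_nonneg hl.const_nonneg
  have hSK : 0 ≤ S + K := add_nonneg hS hl.const_nonneg
  have hA : 0 ≤ S + (S + K) * C := add_nonneg hS (mul_nonneg hSK hf.bound_nonneg)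
  have key : ∀ z ∈ (univ : Set (EuclideanSpace ℝ (Fin n))) ×ˢ Icc (0 : ℝ) T,
      ∀ z' ∈ (univ : Set (EuclideanSpace ℝ (Fin n))) ×ˢ Icc (0 : ℝ) T,
      value f l h U V T z ≤ value f l h U V T z' + (S + (S + K) * C) * dist z z' := by
    rintro ⟨x, t⟩ ⟨-, ht⟩ ⟨x', t'⟩ ⟨-, ht'⟩
    have h1 := value_le_add_state hf hl hh ht.1 ht.2 x' x
    have h2 : value f l h U V T (x', t) ≤
        value f l h U V T (x', t') + (S + K) * (C * |t - t'|) := by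
      rcases le_total t t' with h | h
      · rw [abs_sub_comm, abs_of_nonneg (sub_nonneg.2 h)]
        exact value_le_add_time hf hl hh ht.1 h ht'.2
      · rw [abs_of_nonneg (sub_nonneg.2 h)]
        exact value_ge_sub_time hf hl hh ht'.1 h ht.2
    have h3 : ‖x' - x‖ ≤ dist (x, t) (x', t') := by
      rw [← dist_eq_norm, dist_comm]; exact le_max_left _ _
    have h4 : |t - t'| ≤ dist (x, t) (x', t') := le_max_right (dist x x') (dist t t')
    have h5 := mul_le_mul_of_nonneg_left h3 hS
    have h6 := mul_le_mul_of_nonneg_left h4 (mul_nonneg hSK hf.bound_nonneg)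
    rw [← hSdef] at h1
    linarith
  refine (LipschitzOnWith.of_dist_le_mul (K := ⟨_, hA⟩) fun z hz z' hz' => ?_).continuousOn
  rw [Real.dist_eq, abs_le]
  have h1 := key z hz z' hz'
  have h2 := key z' hz' z hz
  rw [dist_comm] at h2
  change -((S + (S + K) * C) * dist z z') ≤ _ ∧ _ ≤ (S + (S + K) * C) * dist z z'
  constructor <;> linarith

/-! ### The Hamiltonian -/

lemma IsControlSystem.abs_apply_le (hf : IsControlSystem f U V C L) (x : EuclideanSpace ℝ (Fin n))
    (q : EuclideanSpace ℝ (Fin n) →L[ℝ] ℝ) {u : EuclideanSpace ℝ (Fin m)} (hu : u ∈ U)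
    {v : EuclideanSpace ℝ (Fin p)} (hv : v ∈ V) : |q (f x u v)| ≤ ‖q‖ * C :=
  (q.le_opNorm _).trans (mul_le_mul_of_nonneg_left (hf.norm_le x u hu v hv) (norm_nonneg q))

lemma IsControlSystem.bddBelow_range (hf : IsControlSystem f U V C L)
    (x : EuclideanSpace ℝ (Fin n)) (q : EuclideanSpace ℝ (Fin n) →L[ℝ] ℝ) (v : V) :
    BddBelow (range fun u : U => q (f x u v)) :=
  ⟨-(‖q‖ * C), by rintro _ ⟨u, rfl⟩; exact (abs_le.1 (hf.abs_apply_le x q u.2 v.2)).1⟩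

lemma IsControlSystem.bddAbove_range_iInf (hf : IsControlSystem f U V C L)
    (x : EuclideanSpace ℝ (Fin n)) (q : EuclideanSpace ℝ (Fin n) →L[ℝ] ℝ) :
    BddAbove (range fun v : V => ⨅ u : U, q (f x u v)) := by
  obtain ⟨u₀, hu₀⟩ := hf.nonempty_left
  refine ⟨‖q‖ * C, ?_⟩
  rintro _ ⟨v, rfl⟩
  exact (ciInf_le (hf.bddBelow_range x q v) ⟨u₀, hu₀⟩).trans
    (abs_le.1 (hf.abs_apply_le x q hu₀ v.2)).2

lemma exists_lt_of_hamiltonian_lt (hf : IsControlSystem f U V C L)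
    (hb : hamiltonian f U V x q < b) {v : EuclideanSpace ℝ (Fin p)} (hv : v ∈ V) :
    ∃ u ∈ U, q (f x u v) < b := by
  have : Nonempty U := hf.nonempty_left.to_subtype
  obtain ⟨u, hu⟩ := exists_lt_of_ciInf_lt
    ((le_ciSup (hf.bddAbove_range_iInf x q) ⟨v, hv⟩).trans_lt hb)
  exact ⟨u, u.2, hu⟩

lemma exists_forall_lt_of_lt_hamiltonian (hf : IsControlSystem f U V C L)
    (hb : b < hamiltonian f U V x q) : ∃ v ∈ V, ∀ u ∈ U, b < q (f x u v) := by
  have : Nonempty V := hf.nonempty_right.to_subtype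
  obtain ⟨v, hv⟩ := exists_lt_of_lt_ciSup hb
  exact ⟨v, v.2, fun u hu => hv.trans_le (ciInf_le (hf.bddBelow_range x q v) ⟨u, hu⟩)⟩

lemma hamiltonian_le_add (hf : IsControlSystem f U V C L)
    (H : ∀ u ∈ U, ∀ v ∈ V, q (f x u v) ≤ q' (f x' u v) + a) :
    hamiltonian f U V x q ≤ hamiltonian f U V x' q' + a := by
  have : Nonempty V := hf.nonempty_right.to_subtype
  have : Nonempty U := hf.nonempty_left.to_subtype
  refine ciSup_le fun v => ?_
  rw [← sub_le_iff_le_add]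
  refine le_trans ?_ (le_ciSup (hf.bddAbove_range_iInf x' q') v)
  refine le_ciInf fun u => ?_
  rw [sub_le_iff_le_add]
  exact (ciInf_le (hf.bddBelow_range x q v) u).trans (H u u.2 v v.2)

lemma viExpr_of_hasFDerivAt (hW : HasFDerivAt W D (x, t)) (r : ℝ) :
    viExpr f h U V W x t r = max (h x - r)
      (D (0, 1) + hamiltonian f U V x (D.comp (ContinuousLinearMap.inl ℝ _ ℝ))) := by
  have h1 : HasFDerivAt (fun y => W (y, t)) (D.comp (ContinuousLinearMap.inl ℝ _ ℝ)) x :=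
    hW.comp x (hasFDerivAt_prodMk_left x t)
  have h2 : HasDerivAt (fun s => W (x, s)) (D (0, 1)) t := by
    refine (hW.comp t (hasFDerivAt_prodMk_right x t)).hasDerivAt.congr_deriv ?_
    simp
  rw [viExpr, h1.fderiv, h2.deriv]

/-! ### The value function is a viscosity solution -/

/-- All trajectories from `(x, t)` stay close to `(x, t)` for a short time, uniformly in the
inputs. -/
lemma eventually_trajectory_mem (hf : IsControlSystem f U V C L) (htT : t < T)
    {N : Set (EuclideanSpace ℝ (Fin n) × ℝ)} (hN : N ∈ nhds (x, t)) :
    ∀ᶠ t' in nhdsWithin t (Ioi t), t' ≤ T ∧ ∀ u ∈ inputs U t T, ∀ v ∈ inputs V t T, ∀ y,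
      IsTrajectory f t T x u v y → ∀ τ ∈ Icc t t', (y τ, τ) ∈ N := by
  obtain ⟨r, hr, hrN⟩ := Metric.mem_nhds_iff.1 hN
  have hC : 0 < C + 1 := by linarith [hf.bound_nonneg]
  have hd : t < min T (t + r / (C + 1)) := lt_min htT (by have := div_pos hr hC; linarith)
  filter_upwards [Ioo_mem_nhdsGT hd] with t' ht'
  have ht'T : t' < T := ht'.2.trans_le (min_le_left _ _)
  refine ⟨ht'T.le, fun u hu v hv y hy τ hτ => hrN ?_⟩
  have h1 : t' - t < r / (C + 1) := by linarith [ht'.2.trans_le (min_le_right _ _)]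
  have h2 := hy.norm_sub_le hf hu hv ⟨hτ.1, hτ.2.trans ht'T.le⟩
  rw [lt_div_iff₀ hC] at h1
  have h3 := mul_le_mul_of_nonneg_left (sub_le_sub_right hτ.2 t) hC.le
  have h4 := mul_nonneg hf.bound_nonneg (sub_nonneg.2 hτ.1)
  rw [Metric.mem_ball, Prod.dist_eq, max_lt_iff, dist_eq_norm, Real.dist_eq,
    abs_of_nonneg (sub_nonneg.2 hτ.1)]
  constructor <;> linarith [hτ.1]

/-- If `∂W/∂t + ∂W/∂x f ≤ b` at the fixed state `x` along the inputs, then `W` grows at rate at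
most `b + ε` along the trajectory for a short time that does not depend on the inputs. Since the
time is short, differentiability of `W` at the single point `(x, t)` is enough. -/
lemma eventually_sub_le (hf : IsControlSystem f U V C L) (htT : t < T)
    (hW : HasFDerivAt W D (x, t)) {ε : ℝ} (hε : 0 < ε) (b : ℝ) :
    ∀ᶠ t' in nhdsWithin t (Ioi t), ∀ u ∈ inputs U t T, ∀ v ∈ inputs V t T, ∀ y,
      IsTrajectory f t T x u v y → (∀ s ∈ Icc t T, D (f x (u s) (v s), 1) ≤ b) →
        W (y t', t') - W (x, t) ≤ (b + ε) * (t' - t) := by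
  have hC : 0 < C + 1 := by linarith [hf.bound_nonneg]
  have hM : 0 ≤ ‖D‖ * L * C :=
    mul_nonneg (mul_nonneg (norm_nonneg _) hf.lip_nonneg) hf.bound_nonneg
  have hε1 : 0 < ε / (2 * (C + 1)) := by positivity
  have hN : ∀ᶠ z in nhds (x, t), ‖W z - W (x, t) - D (z - (x, t))‖ ≤
      ε / (2 * (C + 1)) * ‖z - (x, t)‖ := hW.isLittleO.def hε1
  have hd : t < t + ε / (2 * (‖D‖ * L * C + 1)) := by
    have : 0 < ε / (2 * (‖D‖ * L * C + 1)) := by positivity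
    linarith
  filter_upwards [eventually_trajectory_mem hf htT hN, Ioo_mem_nhdsGT hd]
    with t' ht' htd u hu v hv y hy hb
  have htt' : t < t' := htd.1
  have hpos : 0 < t' - t := sub_pos.2 htt'
  have ht'mem : t' ∈ Icc t T := ⟨htt'.le, ht'.1⟩
  have h1 := ht'.2 u hu v hv y hy t' ⟨htt'.le, le_rfl⟩
  rw [Prod.mk_sub_mk] at h1
  have hsmall : ‖D‖ * L * C * (t' - t) ≤ ε / 2 := by
    have h2 : t' - t < ε / (2 * (‖D‖ * L * C + 1)) := by linarith [htd.2]
    rw [lt_div_iff₀ (by positivity)] at h2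
    nlinarith
  have hnorm : ‖(y t' - x, t' - t)‖ ≤ (C + 1) * (t' - t) := by
    have := hy.norm_sub_le hf hu hv ht'mem
    have h4 := mul_nonneg hf.bound_nonneg hpos.le
    rw [Prod.norm_mk, max_le_iff, Real.norm_of_nonneg hpos.le]
    constructor <;> linarith
  have hint : IntervalIntegrable (fun s => f (y s) (u s) (v s)) volume t t' :=
    (hy.mono htt'.le ht'.1).1
  have hint2 : IntervalIntegrable (fun s => (f (y s) (u s) (v s), (1 : ℝ))) volume t t' :=
    ⟨hint.1.prodMk intervalIntegrable_const.1, hint.2.prodMk intervalIntegrable_const.2⟩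
  have hD : D (y t' - x, t' - t) = ∫ s in t..t', D (f (y s) (u s) (v s), 1) := by
    rw [D.intervalIntegral_comp_comm hint2]
    congr 1
    have e1 := (ContinuousLinearMap.fst ℝ (EuclideanSpace ℝ (Fin n)) ℝ).intervalIntegral_comp_comm
      hint2
    have e2 := (ContinuousLinearMap.snd ℝ (EuclideanSpace ℝ (Fin n)) ℝ).intervalIntegral_comp_comm
      hint2
    simp only [ContinuousLinearMap.coe_fst', ContinuousLinearMap.coe_snd',
      intervalIntegral.integral_const, smul_eq_mul, mul_one] at e1 e2
    refine Prod.ext ?_ ?_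
    · rw [← e1, hy.2 t' ht'mem, add_sub_cancel_left]
    · exact e2
  have hDle : D (y t' - x, t' - t) ≤ (b + ε / 2) * (t' - t) := by
    rw [hD]
    calc ∫ s in t..t', D (f (y s) (u s) (v s), 1) ≤ ∫ _ in t..t', (b + ε / 2) := by
          refine intervalIntegral.integral_mono_on htt'.le
            ⟨D.integrable_comp hint2.1, D.integrable_comp hint2.2⟩
            intervalIntegrable_const fun s hs => ?_
          have hs' : s ∈ Icc t T := ⟨hs.1, hs.2.trans ht'.1⟩
          have e1 : D (f (y s) (u s) (v s), 1) = D (f x (u s) (v s), 1) +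
              D (f (y s) (u s) (v s) - f x (u s) (v s), 0) := by
            rw [← map_add]; simp
          have e2 : ‖((f (y s) (u s) (v s) - f x (u s) (v s), (0 : ℝ)) :
              EuclideanSpace ℝ (Fin n) × ℝ)‖ ≤ L * (C * (t' - t)) := by
            rw [Prod.norm_mk, norm_zero, max_eq_left (norm_nonneg _)]
            refine (hf.norm_sub_le _ _ _ (hu.2 s hs') _ (hv.2 s hs')).trans
              (mul_le_mul_of_nonneg_left ?_ hf.lip_nonneg)
            exact (hy.norm_sub_le hf hu hv hs').trans
              (mul_le_mul_of_nonneg_left (by linarith [hs.2]) hf.bound_nonneg)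
          have e3 := (le_abs_self _).trans ((D.le_opNorm _).trans
            (mul_le_mul_of_nonneg_left e2 (norm_nonneg D)))
          linarith [hb s hs']
      _ = (b + ε / 2) * (t' - t) := by
          rw [intervalIntegral.integral_const, smul_eq_mul, mul_comm]
  have h5 : ε / (2 * (C + 1)) * ‖(y t' - x, t' - t)‖ ≤ ε / 2 * (t' - t) := by
    refine (mul_le_mul_of_nonneg_left hnorm hε1.le).trans (le_of_eq ?_)
    field_simp
  have h6 := (le_abs_self _).trans (h1.trans h5)
  linarith

/-- A measurable feedback that answers each disturbance value well, glued from finitely many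
constant answers by compactness; continuity of `f` in `v` alone is needed. -/
lemma exists_measurable_feedback (hf : IsControlSystem f U V C L) (hV : IsCompact V)
    (hb : hamiltonian f U V x q < b) :
    ∃ g : EuclideanSpace ℝ (Fin p) → EuclideanSpace ℝ (Fin m), Measurable g ∧
      ∀ v ∈ V, g v ∈ U ∧ q (f x (g v) v) < b := by
  classical
  have key : ∃ O : Set (EuclideanSpace ℝ (Fin p)), IsOpen O ∧ V ⊆ O ∧
      ∃ g : EuclideanSpace ℝ (Fin p) → EuclideanSpace ℝ (Fin m), Measurable g ∧
        ∀ v ∈ O ∩ V, g v ∈ U ∧ q (f x (g v) v) < b := by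
    refine hV.induction_on
      (p := fun S => ∃ O : Set (EuclideanSpace ℝ (Fin p)), IsOpen O ∧ S ⊆ O ∧
        ∃ g : EuclideanSpace ℝ (Fin p) → EuclideanSpace ℝ (Fin m), Measurable g ∧
          ∀ v ∈ O ∩ V, g v ∈ U ∧ q (f x (g v) v) < b) ?_ ?_ ?_ ?_
    · exact ⟨∅, isOpen_empty, Subset.rfl, fun _ => 0, measurable_const, by simp⟩
    · rintro S S' hS ⟨O, hO, hSO, hg⟩
      exact ⟨O, hO, hS.trans hSO, hg⟩
    · rintro S S' ⟨O, hO, hSO, g, hg, hgb⟩ ⟨O', hO', hSO', g', hg', hgb'⟩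
      refine ⟨O ∪ O', hO.union hO', union_subset_union hSO hSO', O.piecewise g g',
        hg.piecewise hO.measurableSet hg', fun v hv => ?_⟩
      by_cases hvO : v ∈ O
      · rw [piecewise_eq_of_mem _ _ _ hvO]; exact hgb v ⟨hvO, hv.2⟩
      · rw [piecewise_eq_of_notMem _ _ _ hvO]; exact hgb' v ⟨hv.1.resolve_left hvO, hv.2⟩
    · intro v hv
      obtain ⟨u, hu, huv⟩ := exists_lt_of_hamiltonian_lt hf hb hv
      obtain ⟨O, hO, hOV⟩ := continuousOn_iff'.1
        (q.continuous.comp_continuousOn (hf.continuousOn_right x u hu)) _ (isOpen_Iio (a := b))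
      have hvO : v ∈ O := (hOV.subset ⟨huv, hv⟩).1
      exact ⟨O, mem_nhdsWithin_of_mem_nhds (hO.mem_nhds hvO), O, hO, Subset.rfl, fun _ => u,
        measurable_const, fun w hw => ⟨hu, (hOV.superset hw).1⟩⟩
  obtain ⟨O, -, hVO, g, hg, hgb⟩ := key
  exact ⟨g, hg, fun v hv => hgb v ⟨hVO hv, hv⟩⟩

lemma value_of_isLocalMax (hf : IsControlSystem f U V C L) (hV : IsCompact V)
    (hl : IsBoundedLipschitz l B K) (hh : IsBoundedLipschitz h B K) (ht : t ∈ Ioo 0 T)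
    (hW : HasFDerivAt W D (x, t))
    (hmax : IsLocalMax (fun z => value f l h U V T z - W z) (x, t)) :
    0 ≤ viExpr f h U V W x t (value f l h U V T (x, t)) := by
  rw [viExpr_of_hasFDerivAt hW]
  set w := value f l h U V T with hw
  set q := D.comp (ContinuousLinearMap.inl ℝ _ ℝ) with hq
  have hDq : ∀ z, D (z, 1) = D (0, 1) + q z := fun z => by
    rw [hq, ContinuousLinearMap.comp_apply, ← map_add]; simp
  by_contra hneg
  obtain ⟨hobs, hham⟩ := max_lt_iff.1 (not_le.1 hneg)
  obtain ⟨θ, hθ, hθH⟩ : ∃ θ, 0 < θ ∧ hamiltonian f U V x q < -θ - D (0, 1) :=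
    ⟨-(D (0, 1) + hamiltonian f U V x q) / 2, by linarith, by linarith⟩
  obtain ⟨g, hg, hgV⟩ := exists_measurable_feedback hf hV hθH
  let γ₀ : strategies U V t T := ⟨fun v => ⟨fun s => g (v.1 s),
    hg.comp_aemeasurable v.2.1, fun s hs => (hgV _ (v.2.2 s hs)).1⟩, fun s _ v v' hvv => by
      filter_upwards [hvv] with τ hτ
      simp only [hτ]⟩
  have hhc : Continuous h := (LipschitzWith.of_dist_le_mul (K := ⟨K, hh.const_nonneg⟩)
    fun z z' => by
      rw [Real.dist_eq, dist_eq_norm]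
      exact hh.abs_sub_le z z').continuous
  have hN : ∀ᶠ z : EuclideanSpace ℝ (Fin n) × ℝ in nhds (x, t), h z.1 < (h x + w (x, t)) / 2 :=
    (hhc.comp continuous_fst).continuousAt.eventually_lt_const
      (show h x < (h x + w (x, t)) / 2 by linarith)
  obtain ⟨t', ⟨hT', hnear⟩, hgrow, htt' : t < t'⟩ :=
    ((eventually_trajectory_mem hf ht.2 (Filter.inter_mem hmax hN)).and
      ((eventually_sub_le hf ht.2 hW (half_pos hθ) (-θ)).and self_mem_nhdsWithin)).exists
  have hpos : 0 < θ * (t' - t) := mul_pos hθ (sub_pos.2 htt')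
  have hlt : w (x, t) ≤ max ((h x + w (x, t)) / 2) (w (x, t) - θ / 4 * (t' - t)) := by
    refine value_le_of_value_lt hf hl hh htt'.le hT' γ₀ fun v y hy => ⟨fun τ hτ => ?_, ?_⟩
    · exact (hnear _ (γ₀.1 v).2 _ v.2 y hy τ hτ).2.le.trans (le_max_left _ _)
    · refine lt_max_of_lt_right ?_
      have h1 : w (y t', t') - W (y t', t') ≤ w (x, t) - W (x, t) :=
        (hnear _ (γ₀.1 v).2 _ v.2 y hy t' ⟨htt'.le, le_rfl⟩).1
      have h2 := hgrow _ (γ₀.1 v).2 _ v.2 y hy fun s hs => by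
        rw [hDq]
        linarith [(hgV _ (v.2.2 s hs)).2]
      rw [← hw]
      linarith
  rcases le_max_iff.1 hlt with h1 | h1 <;> linarith

lemma value_of_isLocalMin (hf : IsControlSystem f U V C L)
    (hl : IsBoundedLipschitz l B K) (hh : IsBoundedLipschitz h B K) (ht : t ∈ Ioo 0 T)
    (hW : HasFDerivAt W D (x, t))
    (hmin : IsLocalMin (fun z => value f l h U V T z - W z) (x, t)) :
    viExpr f h U V W x t (value f l h U V T (x, t)) ≤ 0 := by
  rw [viExpr_of_hasFDerivAt hW]
  set w := value f l h U V T with hw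
  set q := D.comp (ContinuousLinearMap.inl ℝ _ ℝ) with hq
  have hDq : ∀ z, D (z, 1) = D (0, 1) + q z := fun z => by
    rw [hq, ContinuousLinearMap.comp_apply, ← map_add]; simp
  refine max_le (sub_nonpos.2 (obstacle_le_value hf hl hh ht.2.le)) ?_
  by_contra! hneg
  obtain ⟨θ, hθ, hθH⟩ : ∃ θ, 0 < θ ∧ θ - D (0, 1) < hamiltonian f U V x q :=
    ⟨(D (0, 1) + hamiltonian f U V x q) / 2, by linarith, by linarith⟩
  obtain ⟨b, hb, hbU⟩ := exists_forall_lt_of_lt_hamiltonian hf hθH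
  obtain ⟨t', ⟨hT', hnear⟩, hgrow, htt' : t < t'⟩ :=
    ((eventually_trajectory_mem hf ht.2 hmin).and
      ((eventually_sub_le hf ht.2 hW.neg (half_pos hθ) (-θ)).and self_mem_nhdsWithin)).exists
  have hpos : 0 < θ * (t' - t) := mul_pos hθ (sub_pos.2 htt')
  obtain ⟨γ, hγ⟩ := exists_secures hf hl hh ht.2.le
    (show value f l h U V T (x, t) < w (x, t) + θ / 4 * (t' - t) by rw [← hw]; linarith)
  let v : inputs V t T := ⟨_, const_mem_inputs hb⟩
  have hφ := isTrajectory_trajectory hf ht.2.le (γ.1 v).2 v.2 x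
  set φ := trajectory f t T x (γ.1 v).1 v.1
  have h1 : w (φ t', t') ≤ w (x, t) + θ / 4 * (t' - t) := hγ.value_le hf hl hh htt'.le hT' v hφ
  have h2 : w (x, t) - W (x, t) ≤ w (φ t', t') - W (φ t', t') :=
    hnear _ (γ.1 v).2 _ v.2 φ hφ t' ⟨htt'.le, le_rfl⟩
  have h3 := hgrow _ (γ.1 v).2 _ v.2 φ hφ fun s hs => by
    rw [neg_apply, hDq]
    linarith [hbU _ ((γ.1 v).2.2 s hs)]
  simp only [Pi.neg_apply] at h3
  linarith

lemma isViscositySolution_value (hf : IsControlSystem f U V C L) (hV : IsCompact V)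
    (hl : IsBoundedLipschitz l B K) (hh : IsBoundedLipschitz h B K) :
    IsViscositySolution f h U V T (value f l h U V T) := by
  have hD : ∀ W : EuclideanSpace ℝ (Fin n) × ℝ → ℝ, ContDiffOn ℝ ∞ W (univ ×ˢ Ioo 0 T) →
      ∀ x, ∀ t ∈ Ioo 0 T, DifferentiableAt ℝ W (x, t) := fun W hW x t ht =>
    (hW.contDiffAt ((isOpen_univ.prod isOpen_Ioo).mem_nhds ⟨mem_univ x, ht⟩)).differentiableAt
      (by simp)
  exact ⟨continuousOn_value hf hl hh,
    fun W hW x t ht hmax => value_of_isLocalMax hf hV hl hh ht (hD W hW x t ht).hasFDerivAt hmax,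
    fun W hW x t ht hmin => value_of_isLocalMin hf hl hh ht (hD W hW x t ht).hasFDerivAt hmin⟩

/-! ### Test functions for the comparison principle -/

/-- The quadratic penalty `(‖x - y‖² + (t - s)²) / (2 ε)` that couples two copies `(x, t)`, `(y, s)`
of space-time. -/
noncomputable def penalty (ε : ℝ) (z z' : EuclideanSpace ℝ (Fin n) × ℝ) : ℝ :=
  (‖z.1 - z'.1‖ ^ 2 + (z.2 - z'.2) ^ 2) / (2 * ε)

/-- The differential of `penalty ε · (y, s)` at `(x, t)`; it is also the differential of
`-penalty ε (x, t) ·` at `(y, s)`. -/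
noncomputable def penaltyDeriv (ε : ℝ) (z z' : EuclideanSpace ℝ (Fin n) × ℝ) :
    EuclideanSpace ℝ (Fin n) × ℝ →L[ℝ] ℝ :=
  ε⁻¹ • ((innerSL ℝ (z.1 - z'.1)).comp (ContinuousLinearMap.fst ℝ _ ℝ) +
    (z.2 - z'.2) • ContinuousLinearMap.snd ℝ _ ℝ)

/-- With `(x₀, t₀) = z₀`, the function
`η * (exp (k * (√(1 + ‖x - x₀‖²) - 1 - C * (t - t₀))) + 1 / t)`. For large `k` it is large outside
a cone with apex `z₀`, opening towards later times with speed `C`; its second term is large near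
time `0` and makes the inequality in `hasFDerivAt_barrier` strict. -/
noncomputable def barrier (C k η : ℝ) (z₀ z : EuclideanSpace ℝ (Fin n) × ℝ) : ℝ :=
  η * (Real.exp (k * (√(1 + ‖z.1 - z₀.1‖ ^ 2) - 1 - C * (z.2 - z₀.2))) + z.2⁻¹)

lemma penalty_comm (ε : ℝ) (z z' : EuclideanSpace ℝ (Fin n) × ℝ) :
    penalty ε z z' = penalty ε z' z := by
  rw [penalty, penalty, norm_sub_rev, ← neg_sub z'.2, neg_sq]

lemma penaltyDeriv_comm (ε : ℝ) (z z' : EuclideanSpace ℝ (Fin n) × ℝ) :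
    penaltyDeriv ε z' z = -penaltyDeriv ε z z' := by
  refine ContinuousLinearMap.ext fun w => ?_
  simp [penaltyDeriv]
  ring

lemma contDiff_penalty (ε : ℝ) (z' : EuclideanSpace ℝ (Fin n) × ℝ) :
    ContDiff ℝ ∞ fun z => penalty ε z z' :=
  ((((contDiff_fst.sub contDiff_const).norm_sq ℝ).add
    ((contDiff_snd.sub contDiff_const).pow 2)).div_const _)

lemma hasFDerivAt_penalty (ε : ℝ) (z z' : EuclideanSpace ℝ (Fin n) × ℝ) :
    HasFDerivAt (fun z => penalty ε z z') (penaltyDeriv ε z z') z := by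
  have h1 : HasFDerivAt (fun z : EuclideanSpace ℝ (Fin n) × ℝ => ‖z.1 - z'.1‖ ^ 2) _ z :=
    (hasFDerivAt_fst.sub_const z'.1).norm_sq
  have h2 : HasFDerivAt (fun z : EuclideanSpace ℝ (Fin n) × ℝ => (z.2 - z'.2) ^ 2) _ z :=
    ((hasFDerivAt_snd (𝕜 := ℝ) (p := z)).sub_const z'.2).pow 2
  have h3 := (h1.add h2).const_mul (2 * ε)⁻¹
  refine (h3.congr_fderiv ?_).congr_of_eventuallyEq
    (Filter.Eventually.of_forall fun z => ?_)
  · refine ContinuousLinearMap.ext fun w => ?_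
    simp [penaltyDeriv]
    ring
  · simp [penalty, div_eq_inv_mul]

lemma penaltyDeriv_comp_inl (ε : ℝ) (z z' : EuclideanSpace ℝ (Fin n) × ℝ) :
    (penaltyDeriv ε z z').comp (ContinuousLinearMap.inl ℝ _ ℝ) =
      ε⁻¹ • innerSL ℝ (z.1 - z'.1) := by
  ext w
  simp [penaltyDeriv]

lemma contDiffOn_barrier (C k η : ℝ) (z₀ : EuclideanSpace ℝ (Fin n) × ℝ) :
    ContDiffOn ℝ ∞ (barrier C k η z₀) (univ ×ˢ Ioi 0) := by
  have h1 : ContDiff ℝ ∞ fun z : EuclideanSpace ℝ (Fin n) × ℝ => √(1 + ‖z.1 - z₀.1‖ ^ 2) :=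
    (contDiff_const.add ((contDiff_fst.sub contDiff_const).norm_sq ℝ)).sqrt
      fun z => by positivity
  refine contDiffOn_const.mul (ContDiffOn.add ?_ ?_)
  · exact (contDiff_const.mul ((h1.sub contDiff_const).sub
      (contDiff_const.mul (contDiff_snd.sub contDiff_const)))).exp.contDiffOn
  · exact contDiff_snd.contDiffOn.inv fun z hz => (mem_Ioi.1 hz.2).ne'

/-- The barrier is a strict supersolution of `∂w/∂t + C ‖∂w/∂x‖ = 0`, because
`√(1 + ‖x - x₀‖²)` has slope at most one. -/
lemma hasFDerivAt_barrier {k η : ℝ} (hC : 0 ≤ C) (hk : 0 ≤ k) (hη : 0 ≤ η)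
    (z₀ : EuclideanSpace ℝ (Fin n) × ℝ) (x : EuclideanSpace ℝ (Fin n)) (ht : 0 < t) :
    ∃ D : EuclideanSpace ℝ (Fin n) × ℝ →L[ℝ] ℝ, HasFDerivAt (barrier C k η z₀) D (x, t) ∧
      D (0, 1) + ‖D.comp (ContinuousLinearMap.inl ℝ (EuclideanSpace ℝ (Fin n)) ℝ)‖ * C ≤
        -(η / t ^ 2) := by
  set r : ℝ := √(1 + ‖x - z₀.1‖ ^ 2) with hr
  have hr0 : 0 < r := by positivity
  have h1 : HasFDerivAt
      (fun z : EuclideanSpace ℝ (Fin n) × ℝ => √(1 + ‖z.1 - z₀.1‖ ^ 2)) _ (x, t) :=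
    (((hasFDerivAt_fst (𝕜 := ℝ) (p := (x, t))).sub_const z₀.1).norm_sq.const_add 1).sqrt
      (by positivity)
  have h2 : HasFDerivAt (fun z : EuclideanSpace ℝ (Fin n) × ℝ => C * (z.2 - z₀.2)) _ (x, t) :=
    ((hasFDerivAt_snd (𝕜 := ℝ) (p := (x, t))).sub_const z₀.2).const_mul C
  have h3 : HasFDerivAt (fun z : EuclideanSpace ℝ (Fin n) × ℝ => z.2⁻¹) _ (x, t) :=
    (hasDerivAt_inv ht.ne').comp_hasFDerivAt (x, t) (hasFDerivAt_snd (𝕜 := ℝ))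
  have h4 := (((((h1.sub_const 1).sub h2).const_mul k).exp).add h3).const_mul η
  set e : ℝ := Real.exp (k * (√(1 + ‖x - z₀.1‖ ^ 2) - 1 - C * (t - z₀.2))) with he
  have he0 : 0 < e := Real.exp_pos _
  set A : EuclideanSpace ℝ (Fin n) →L[ℝ] ℝ := r⁻¹ • innerSL ℝ (x - z₀.1) with hA
  have hA1 : ‖A‖ ≤ 1 := by
    rw [hA, norm_smul, innerSL_apply_norm, norm_inv, Real.norm_of_nonneg hr0.le,
      inv_mul_le_iff₀ hr0, mul_one]
    exact Real.le_sqrt_of_sq_le (by linarith)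
  refine ⟨η • (e • k • (A.comp (ContinuousLinearMap.fst ℝ _ ℝ) -
    C • ContinuousLinearMap.snd ℝ _ ℝ) + (-(t ^ 2)⁻¹) • ContinuousLinearMap.snd ℝ _ ℝ),
    h4.congr_fderiv ?_, ?_⟩
  · refine ContinuousLinearMap.ext fun w => ?_
    simp [hA, he, ← hr]
    left
    ring_nf
    simp
  · have e2 : (η • (e • k • (A.comp (ContinuousLinearMap.fst ℝ _ ℝ) -
        C • ContinuousLinearMap.snd ℝ _ ℝ) +
          (-(t ^ 2)⁻¹) • ContinuousLinearMap.snd ℝ _ ℝ)).comp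
        (ContinuousLinearMap.inl ℝ (EuclideanSpace ℝ (Fin n)) ℝ) = (η * e * k) • A := by
      ext w
      simp
      ring
    have hc : 0 ≤ η * e * k := by positivity
    rw [e2, norm_smul, Real.norm_of_nonneg hc]
    have h5 := mul_le_mul_of_nonneg_right (mul_le_mul_of_nonneg_left hA1 hc) hC
    simp
    rw [div_eq_mul_inv]
    linarith

/-! ### The comparison principle -/

lemma continuous_penalty (ε : ℝ) :
    Continuous fun z : (EuclideanSpace ℝ (Fin n) × ℝ) × (EuclideanSpace ℝ (Fin n) × ℝ) =>
      penalty ε z.1 z.2 := by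
  unfold penalty
  fun_prop

lemma penalty_self (ε : ℝ) (z : EuclideanSpace ℝ (Fin n) × ℝ) : penalty ε z z = 0 := by
  simp [penalty]

lemma penalty_nonneg {ε : ℝ} (hε : 0 ≤ ε) (z z' : EuclideanSpace ℝ (Fin n) × ℝ) :
    0 ≤ penalty ε z z' := by
  unfold penalty
  positivity

/-- A penalty of at most `M` forces the two points to be `r`-close, for a small parameter. -/
lemma exists_dist_lt_of_penalty_le {M r : ℝ} (hM : 0 < M) (hr : 0 < r) :
    ∃ ε > 0, ∀ z z' : EuclideanSpace ℝ (Fin n) × ℝ, penalty ε z z' ≤ M → dist z z' < r := by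
  refine ⟨r ^ 2 / (4 * M), by positivity, fun z z' hp => ?_⟩
  rw [penalty, div_le_iff₀ (by positivity)] at hp
  have e1 : M * (2 * (r ^ 2 / (4 * M))) = r ^ 2 / 2 := by field_simp; norm_num
  have e2 : r ^ 2 / 2 < r ^ 2 := by nlinarith
  rw [Prod.dist_eq, max_lt_iff, dist_eq_norm, Real.dist_eq]
  constructor
  · exact lt_of_pow_lt_pow_left₀ 2 hr.le (by nlinarith [sq_nonneg (z.2 - z'.2)])
  · exact lt_of_pow_lt_pow_left₀ 2 hr.le (by
      rw [sq_abs]; nlinarith [sq_nonneg ‖z.1 - z'.1‖])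

/-- The barrier can be at most `d` at `z₀` and yet at least `M` near time `0` and at distance
`C * T + 2` from `z₀`. -/
lemma exists_barrier (hC : 0 ≤ C) {z₀ : EuclideanSpace ℝ (Fin n) × ℝ} (hz₀ : 0 < z₀.2) {d M : ℝ}
    (hd : 0 < d) (hM : 0 < M) :
    ∃ k η τ₀ : ℝ, 0 ≤ k ∧ 0 < η ∧ 0 < τ₀ ∧ barrier C k η z₀ z₀ ≤ d ∧
      ∀ z : EuclideanSpace ℝ (Fin n) × ℝ, 0 < z.2 → z.2 ≤ T → barrier C k η z₀ z < M →
        τ₀ < z.2 ∧ ‖z.1 - z₀.1‖ < C * T + 2 := by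
  obtain ⟨η, hη, hηd⟩ : ∃ η > 0, η * (1 + z₀.2⁻¹) = d :=
    ⟨d / (1 + z₀.2⁻¹), by positivity, by field_simp⟩
  refine ⟨M / η, η, η / M, by positivity, hη, by positivity, by simp [barrier, ← hηd],
    fun z hz hzT hb => ?_⟩
  rw [barrier, mul_add] at hb
  constructor
  · have e1 : 0 < η * Real.exp (M / η * (√(1 + ‖z.1 - z₀.1‖ ^ 2) - 1 - C * (z.2 - z₀.2))) := by
      positivity
    have e2 : η * z.2⁻¹ < M := by linarith
    rwa [← div_eq_mul_inv, div_lt_comm₀ hz hM] at e2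
  · by_contra! hge
    have hT : 0 < T := hz.trans_le hzT
    have e1 : C * T + 2 ≤ √(1 + ‖z.1 - z₀.1‖ ^ 2) := by
      refine Real.le_sqrt_of_sq_le ?_
      have : (C * T + 2) ^ 2 ≤ ‖z.1 - z₀.1‖ ^ 2 := by gcongr
      linarith
    have e2 : C * (z.2 - z₀.2) ≤ C * T := mul_le_mul_of_nonneg_left (by linarith) hC
    have e3 : M / η ≤ M / η * (√(1 + ‖z.1 - z₀.1‖ ^ 2) - 1 - C * (z.2 - z₀.2)) :=
      le_mul_of_one_le_right (by positivity) (by linarith)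
    have e4 := mul_le_mul_of_nonneg_left
      ((Real.add_one_le_exp _).trans (Real.exp_le_exp.2 e3)) hη.le
    have e5 : η * (M / η + 1) = M + η := by field_simp
    have e6 : 0 < η * z.2⁻¹ := by positivity
    linarith

/-- A point where two functions, ordered at time `T`, are out of order gives, for every `σ`, an
interior local maximum of the doubled functional whose penalty is at most `σ`. The maximum is taken
over a compact set, and the barrier keeps it away from the lateral boundary and from time `0`; no
growth condition on `w₁` and `w₂` is needed. -/
lemma exists_doubled_max (hC : 0 ≤ C)
    (h₁ : ContinuousOn w₁ (univ ×ˢ Icc 0 T)) (h₂ : ContinuousOn w₂ (univ ×ˢ Icc 0 T))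
    (hle : ∀ x, w₁ (x, T) ≤ w₂ (x, T)) {z₀ : EuclideanSpace ℝ (Fin n) × ℝ}
    (hz₀ : z₀.2 ∈ Ioo 0 T) (hlt : w₂ z₀ < w₁ z₀) :
    ∃ k η δ : ℝ, 0 ≤ k ∧ 0 < η ∧ 0 < δ ∧ ∀ σ > 0, ∃ ε > 0,
      ∃ z z' : EuclideanSpace ℝ (Fin n) × ℝ, z.2 ∈ Ioo 0 T ∧ z'.2 ∈ Ioo 0 T ∧
        ‖z.1 - z'.1‖ ≤ σ ∧ penalty ε z z' ≤ σ ∧ δ ≤ w₁ z - w₂ z' ∧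
        IsLocalMax (fun y => w₁ y - (penalty ε y z' + barrier C k η z₀ y)) z ∧
        IsLocalMin (fun y => w₂ y - -penalty ε y z) z' := by
  obtain ⟨ht₀, ht₀T⟩ := hz₀
  have hT : 0 < T := ht₀.trans ht₀T
  obtain ⟨d, hd⟩ : ∃ d, d = w₁ z₀ - w₂ z₀ := ⟨_, rfl⟩
  have hd0 : 0 < d := hd ▸ sub_pos.2 hlt
  obtain ⟨R, hR⟩ : ∃ R, R = C * T + 2 := ⟨_, rfl⟩
  have hR0 : 0 < R := hR ▸ by positivity
  let Q : Set (EuclideanSpace ℝ (Fin n) × ℝ) := Metric.closedBall z₀.1 (R + 1) ×ˢ Icc 0 T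
  have hQc : IsCompact Q := (isCompact_closedBall _ _).prod isCompact_Icc
  have hQsub : Q ⊆ univ ×ˢ Icc 0 T := prod_mono (subset_univ _) Subset.rfl
  obtain ⟨M, hM0, hMle⟩ : ∃ M > 0, ∀ z ∈ Q, ∀ z' ∈ Q, w₁ z - w₂ z' ≤ M := by
    obtain ⟨M₁, hM₁⟩ := hQc.exists_bound_of_continuousOn (h₁.mono hQsub)
    obtain ⟨M₂, hM₂⟩ := hQc.exists_bound_of_continuousOn (h₂.mono hQsub)
    refine ⟨|M₁| + |M₂| + 1, by positivity, fun z hz z' hz' => ?_⟩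
    have e1 := (le_abs_self _).trans ((hM₁ z hz).trans (le_abs_self _))
    have e2 := (neg_le_abs _).trans ((hM₂ z' hz').trans (le_abs_self _))
    linarith
  have hz₀Q : z₀ ∈ Q := ⟨Metric.mem_closedBall_self (by positivity), ht₀.le, ht₀T.le⟩
  have hdM : d ≤ M := hd ▸ hMle z₀ hz₀Q z₀ hz₀Q
  obtain ⟨k, η, τ₀, hk, hη, hτ₀, hbar₀, hbar⟩ := exists_barrier (T := T) (M := M) hC ht₀
    (show 0 < d / 4 by positivity) hM0
  obtain ⟨hτ₀t, -⟩ := hbar z₀ ht₀ ht₀T.le (by linarith)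
  refine ⟨k, η, d / 2, hk, hη, by positivity, fun σ hσ => ?_⟩
  obtain ⟨σ', hσ'0, hσ'σ, hσ'd⟩ : ∃ σ' > 0, σ' ≤ σ ∧ σ' ≤ d / 2 :=
    ⟨min σ (d / 2), by positivity, by simp, by simp⟩
  obtain ⟨r₁, hr₁, hu₁⟩ := Metric.uniformContinuousOn_iff.1
    (hQc.uniformContinuousOn_of_continuous (h₁.mono hQsub)) σ' hσ'0
  obtain ⟨r₂, hr₂, hu₂⟩ := Metric.uniformContinuousOn_iff.1
    (hQc.uniformContinuousOn_of_continuous (h₂.mono hQsub)) σ' hσ'0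
  obtain ⟨r, hr0, hrr₁, hrr₂, hr1, hrτ, hrσ⟩ :
      ∃ r > 0, r ≤ r₁ ∧ r ≤ r₂ ∧ r ≤ 1 ∧ r ≤ τ₀ ∧ r ≤ σ :=
    ⟨min r₁ (min r₂ (min 1 (min τ₀ σ))), by positivity, by simp, by simp, by simp, by simp,
      by simp⟩
  obtain ⟨ε, hε0, hpen⟩ := exists_dist_lt_of_penalty_le (n := n) hM0 hr0
  let P : Set (EuclideanSpace ℝ (Fin n) × ℝ) := Metric.closedBall z₀.1 R ×ˢ Icc τ₀ T
  have hPQ : P ⊆ Q := prod_mono (Metric.closedBall_subset_closedBall (by linarith))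
    (Icc_subset_Icc_left hτ₀.le)
  have hPc : IsCompact P := (isCompact_closedBall _ _).prod isCompact_Icc
  have hΨc : ContinuousOn
      (fun z : (EuclideanSpace ℝ (Fin n) × ℝ) × (EuclideanSpace ℝ (Fin n) × ℝ) =>
        w₁ z.1 - w₂ z.2 - penalty ε z.1 z.2 - barrier C k η z₀ z.1) (P ×ˢ Q) := by
    refine ((ContinuousOn.sub ?_ ?_).sub (continuous_penalty ε).continuousOn).sub ?_
    · exact (h₁.mono (hPQ.trans hQsub)).comp continuousOn_fst fun z hz => hz.1
    · exact (h₂.mono hQsub).comp continuousOn_snd fun z hz => hz.2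
    · exact (contDiffOn_barrier C k η z₀).continuousOn.comp continuousOn_fst
        fun z hz => ⟨mem_univ _, hτ₀.trans_le hz.1.2.1⟩
  have hz₀P : z₀ ∈ P := ⟨Metric.mem_closedBall_self hR0.le, hτ₀t.le, ht₀T.le⟩
  obtain ⟨z, hzP, z', hz'Q, hmax⟩ : ∃ z ∈ P, ∃ z' ∈ Q, ∀ y ∈ P, ∀ y' ∈ Q,
      w₁ y - w₂ y' - penalty ε y y' - barrier C k η z₀ y ≤
        w₁ z - w₂ z' - penalty ε z z' - barrier C k η z₀ z := by
    obtain ⟨⟨z, z'⟩, ⟨hzP, hz'Q⟩, hmax⟩ :=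
      (hPc.prod hQc).exists_isMaxOn ⟨(z₀, z₀), hz₀P, hz₀Q⟩ hΨc
    exact ⟨z, hzP, z', hz'Q, fun y hy y' hy' => hmax (show (y, y') ∈ P ×ˢ Q from ⟨hy, hy'⟩)⟩
  have hzQ := hPQ hzP
  have hzt : 0 < z.2 := hτ₀.trans_le hzP.2.1
  have hpen0 := penalty_nonneg hε0.le z z'
  have hbar0 : 0 ≤ barrier C k η z₀ z := by unfold barrier; positivity
  have hΨz := hmax z₀ hz₀P z₀ hz₀Q
  rw [penalty_self] at hΨz
  have hΨle := hMle z hzQ z' hz'Q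
  have hdist : dist z z' < r := hpen z z' (by linarith)
  obtain ⟨hzτ, hzR⟩ := hbar z hzt hzP.2.2 (by linarith)
  rw [← hR, ← dist_eq_norm] at hzR
  have hnear : dist z.1 z'.1 < r := (le_max_left _ _).trans_lt hdist
  have hnear' : |z.2 - z'.2| < r := (le_max_right (dist z.1 z'.1) _).trans_lt hdist
  have hz'R : dist z'.1 z₀.1 < R + 1 := by linarith [dist_triangle_left z'.1 z₀.1 z.1]
  have hz't : 0 < z'.2 := by linarith [(abs_lt.1 hnear').2]
  have hc₁ : |w₁ z - w₁ z'| < σ' := hu₁ z hzQ z' hz'Q (hdist.trans_le hrr₁)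
  have hc₂ : |w₂ z - w₂ z'| < σ' := hu₂ z hzQ z' hz'Q (hdist.trans_le hrr₂)
  -- at the final time the two functions are in order, so the maximum is taken earlier
  have hzT : z.2 < T := by
    refine lt_of_le_of_ne hzP.2.2 fun heq => ?_
    have e1 : w₁ z ≤ w₂ z := by
      have := hle z.1
      rwa [← heq] at this
    linarith [(abs_lt.1 hc₂).2]
  have hz'T : z'.2 < T := by
    refine lt_of_le_of_ne hz'Q.2.2 fun heq => ?_
    have e1 : w₁ z' ≤ w₂ z' := by
      have := hle z'.1
      rwa [← heq] at this
    linarith [(abs_lt.1 hc₁).2]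
  refine ⟨ε, hε0, z, z', ⟨hzt, hzT⟩, ⟨hz't, hz'T⟩,
    (dist_eq_norm z.1 z'.1) ▸ hnear.le.trans hrσ, ?_, by linarith, ?_, ?_⟩
  · have e1 := hmax z hzP z hzQ
    rw [penalty_self] at e1
    linarith [(abs_lt.1 hc₂).2]
  · have hPn : P ∈ nhds z := prod_mem_nhds (Metric.closedBall_mem_nhds_of_mem hzR)
      (Icc_mem_nhds hzτ hzT)
    filter_upwards [hPn] with y hy
    linarith [hmax y hy z' hz'Q]
  · have hQn : Q ∈ nhds z' := prod_mem_nhds (Metric.closedBall_mem_nhds_of_mem hz'R)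
      (Icc_mem_nhds hz't hz'T)
    filter_upwards [hQn] with y hy
    rw [penalty_comm ε y, penalty_comm ε z']
    linarith [hmax z hzP y hy]

/-- At a doubled maximum the two inequalities are subtracted. The time derivatives and the main parts
of the gradients cancel, `‖a - b‖² / ε` bounds the error from the two base points, and the strict
inequality for the barrier is contradicted once `σ` is small. -/
lemma le_of_isViscositySolution_interior (hf : IsControlSystem f U V C L)
    (hh : IsBoundedLipschitz h B K) (h₁ : IsViscositySolution f h U V T w₁)
    (h₂ : IsViscositySolution f h U V T w₂) (hle : ∀ x, w₁ (x, T) ≤ w₂ (x, T))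
    (x : EuclideanSpace ℝ (Fin n)) (ht : t ∈ Ioo 0 T) : w₁ (x, t) ≤ w₂ (x, t) := by
  by_contra! hlt
  obtain ⟨k, η, δ, hk, hη, hδ, H⟩ := exists_doubled_max hf.bound_nonneg h₁.continuousOn
    h₂.continuousOn hle (z₀ := (x, t)) ht hlt
  have hT : 0 < T := ht.1.trans ht.2
  have hL1 : 0 < L + 1 := by linarith [hf.lip_nonneg]
  have hK1 : 0 < K + 1 := by linarith [hh.const_nonneg]
  obtain ⟨σ, hσ, hσK, hσL⟩ : ∃ σ > 0, K * σ < δ ∧ 2 * L * σ < η / T ^ 2 := by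
    refine ⟨min (δ / (K + 1)) (η / T ^ 2 / (2 * (L + 1))), by positivity, ?_, ?_⟩
    · have e1 := min_le_left (δ / (K + 1)) (η / T ^ 2 / (2 * (L + 1)))
      rw [le_div_iff₀ hK1] at e1
      have : 0 < min (δ / (K + 1)) (η / T ^ 2 / (2 * (L + 1))) := by positivity
      linarith
    · have e1 := min_le_right (δ / (K + 1)) (η / T ^ 2 / (2 * (L + 1)))
      rw [le_div_iff₀ (by positivity)] at e1
      have : 0 < min (δ / (K + 1)) (η / T ^ 2 / (2 * (L + 1))) := by positivity
      linarith
  obtain ⟨ε, hε, ⟨a, s⟩, ⟨b, r⟩, hs, hr, hab, hpen, hδ', hmax, hmin⟩ := H σ hσ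
  simp only at hs hr hab
  obtain ⟨D, hD, hDle⟩ := hasFDerivAt_barrier (C := C) hf.bound_nonneg hk hη.le (x, t) a hs.1
  have e₁ := h₁.of_isLocalMax _ ((contDiff_penalty ε (b, r)).contDiffOn.add
    ((contDiffOn_barrier C k η (x, t)).mono
      (prod_mono Subset.rfl Ioo_subset_Ioi_self))) a s hs hmax
  have e₂ := h₂.of_isLocalMin _ (contDiff_penalty ε (a, s)).neg.contDiffOn b r hr hmin
  have hD₁ : HasFDerivAt (fun y => penalty ε y (b, r) + barrier C k η (x, t) y)
      (penaltyDeriv ε (a, s) (b, r) + D) (a, s) := (hasFDerivAt_penalty ε (a, s) (b, r)).add hD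
  have hD₂ : HasFDerivAt (fun y => -penalty ε y (a, s)) (penaltyDeriv ε (a, s) (b, r)) (b, r) := by
    have := (hasFDerivAt_penalty ε (b, r) (a, s)).neg
    rwa [penaltyDeriv_comm, neg_neg] at this
  rw [viExpr_of_hasFDerivAt hD₁] at e₁
  rw [viExpr_of_hasFDerivAt hD₂] at e₂
  obtain ⟨e₂, e₃⟩ := max_le_iff.1 e₂
  rcases le_max_iff.1 e₁ with e₁ | e₁
  -- `w₁ ≤ h` at the first point and `h ≤ w₂` at the second
  · have := hh.le_add a b
    have := mul_le_mul_of_nonneg_left hab hh.const_nonneg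
    linarith
  · set q := penaltyDeriv ε (a, s) (b, r) with hq
    have hqn : ‖q.comp (ContinuousLinearMap.inl ℝ _ ℝ)‖ = ε⁻¹ * ‖a - b‖ := by
      rw [hq, penaltyDeriv_comp_inl, norm_smul, innerSL_apply_norm, norm_inv,
        Real.norm_of_nonneg hε.le]
    have hH : hamiltonian f U V a ((q + D).comp (ContinuousLinearMap.inl ℝ _ ℝ)) ≤
        hamiltonian f U V b (q.comp (ContinuousLinearMap.inl ℝ _ ℝ)) +
          (‖D.comp (ContinuousLinearMap.inl ℝ (EuclideanSpace ℝ (Fin n)) ℝ)‖ * C +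
            2 * L * σ) := by
      refine hamiltonian_le_add hf fun u hu v hv => ?_
      set q' := q.comp (ContinuousLinearMap.inl ℝ _ ℝ)
      set D' := D.comp (ContinuousLinearMap.inl ℝ (EuclideanSpace ℝ (Fin n)) ℝ)
      have g1 := (abs_le.1 (hf.abs_apply_le a D' hu hv)).2
      have g2 : q' (f a u v) - q' (f b u v) ≤ 2 * L * σ := by
        rw [← map_sub]
        refine (le_abs_self _).trans ((q'.le_opNorm _).trans ?_)
        rw [hqn]
        have g3 : ‖a - b‖ ^ 2 ≤ σ * (2 * ε) := by
          rw [penalty, div_le_iff₀ (by positivity)] at hpen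
          simp only at hpen
          nlinarith [sq_nonneg (s - r)]
        calc ε⁻¹ * ‖a - b‖ * ‖f a u v - f b u v‖ ≤ ε⁻¹ * ‖a - b‖ * (L * ‖a - b‖) := by
              have := hf.norm_sub_le a b u hu v hv
              gcongr
          _ = ε⁻¹ * L * ‖a - b‖ ^ 2 := by ring
          _ ≤ ε⁻¹ * L * (σ * (2 * ε)) := by
              have := hf.lip_nonneg
              gcongr
          _ = 2 * L * σ := by field_simp
      rw [ContinuousLinearMap.add_comp, add_apply]
      linarith
    have hηs : η / T ^ 2 ≤ η / s ^ 2 := by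
      have := hs.1
      have := hs.2.le
      gcongr
    rw [add_apply] at e₁
    linarith

/-- Comparison principle: viscosity solutions that are ordered at time `T` are ordered. -/
lemma le_of_isViscositySolution (hf : IsControlSystem f U V C L)
    (hh : IsBoundedLipschitz h B K) (h₁ : IsViscositySolution f h U V T w₁)
    (h₂ : IsViscositySolution f h U V T w₂) (hle : ∀ x, w₁ (x, T) ≤ w₂ (x, T))
    (x : EuclideanSpace ℝ (Fin n)) (ht : t ∈ Icc 0 T) : w₁ (x, t) ≤ w₂ (x, t) := by
  rcases ht.2.eq_or_lt with rfl | htT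
  · exact hle x
  have hsub : (fun s => (x, s)) '' Ioo t T ⊆ univ ×ˢ Icc 0 T := by
    rintro _ ⟨s, hs, rfl⟩
    exact ⟨mem_univ _, ht.1.trans hs.1.le, hs.2.le⟩
  have hmem : (x, t) ∈ closure ((fun s => (x, s)) '' Ioo t T) := by
    refine image_closure_subset_closure_image (by fun_prop) ⟨t, ?_, rfl⟩
    rw [closure_Ioo htT.ne]
    exact ⟨le_rfl, htT.le⟩
  refine ContinuousWithinAt.closure_le hmem
    ((h₁.continuousOn (x, t) ⟨mem_univ _, ht⟩).mono hsub)
    ((h₂.continuousOn (x, t) ⟨mem_univ _, ht⟩).mono hsub) ?_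
  rintro _ ⟨s, hs, rfl⟩
  exact le_of_isViscositySolution_interior hf hh h₁ h₂ hle x ⟨ht.1.trans_lt hs.1, hs.2⟩

end ReachAvoid

theorem theorem1 {n m p : ℕ} (T : ℝ) (hT : 0 ≤ T)
    (U : Set (EuclideanSpace ℝ (Fin m))) (V : Set (EuclideanSpace ℝ (Fin p)))
    (hU : IsCompact U) (hU0 : U.Nonempty) (hV : IsCompact V) (hV0 : V.Nonempty)
    (f : EuclideanSpace ℝ (Fin n) → EuclideanSpace ℝ (Fin m) → EuclideanSpace ℝ (Fin p) →
      EuclideanSpace ℝ (Fin n))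
    (l h : EuclideanSpace ℝ (Fin n) → ℝ)
    (hf_bdd : ∃ C : ℝ, ∀ x, ∀ u ∈ U, ∀ v ∈ V, ‖f x u v‖ ≤ C)
    (hf_lip : ∃ C : ℝ, ∀ x x', ∀ u ∈ U, ∀ v ∈ V, ‖f x u v - f x' u v‖ ≤ C * ‖x - x'‖)
    (hf_cont_u : ∀ x, ∀ v ∈ V, ContinuousOn (fun u => f x u v) U)
    (hf_cont_v : ∀ x, ∀ u ∈ U, ContinuousOn (fun v => f x u v) V)
    (hl_bdd : ∃ C : ℝ, ∀ x, |l x| ≤ C)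
    (hl_lip : ∃ C : ℝ, ∀ x x', |l x - l x'| ≤ C * ‖x - x'‖)
    (hh_bdd : ∃ C : ℝ, ∀ x, |h x| ≤ C)
    (hh_lip : ∃ C : ℝ, ∀ x x', |h x - h x'| ≤ C * ‖x - x'‖) :
    -- the trajectories that enter the value function exist and are unique
    (∀ t ∈ Icc 0 T, ∀ x, ∀ u ∈ ReachAvoid.inputs U t T, ∀ v ∈ ReachAvoid.inputs V t T,
      ReachAvoid.IsTrajectory f t T x u v (ReachAvoid.trajectory f t T x u v) ∧
      ∀ y, ReachAvoid.IsTrajectory f t T x u v y →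
        EqOn y (ReachAvoid.trajectory f t T x u v) (Icc t T)) ∧
    -- the value function is a viscosity solution with the terminal condition
    ReachAvoid.IsViscositySolution f h U V T (ReachAvoid.value f l h U V T) ∧
    (∀ x, ReachAvoid.value f l h U V T (x, T) = max (l x) (h x)) ∧
    -- and it is the only one
    (∀ w : EuclideanSpace ℝ (Fin n) × ℝ → ℝ,
      ReachAvoid.IsViscositySolution f h U V T w →
      (∀ x, w (x, T) = max (l x) (h x)) →
      EqOn w (ReachAvoid.value f l h U V T) (univ ×ˢ Icc 0 T)) := by
  obtain ⟨C, hC⟩ := hf_bdd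
  obtain ⟨L, hL⟩ := hf_lip
  obtain ⟨Bl, hBl⟩ := hl_bdd
  obtain ⟨Bh, hBh⟩ := hh_bdd
  obtain ⟨Kl, hKl⟩ := hl_lip
  obtain ⟨Kh, hKh⟩ := hh_lip
  have hf : ReachAvoid.IsControlSystem f U V (max C 0) (max L 0) :=
    ⟨hU0, hV0, le_max_right _ _, le_max_right _ _,
      fun x u hu v hv => (hC x u hu v hv).trans (le_max_left _ _),
      fun x x' u hu v hv => (hL x x' u hu v hv).trans
        (mul_le_mul_of_nonneg_right (le_max_left _ _) (norm_nonneg _)), hf_cont_u, hf_cont_v⟩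
  have hl : ReachAvoid.IsBoundedLipschitz l (max Bl Bh) (max (max Kl Kh) 0) :=
    ⟨fun x => (hBl x).trans (le_max_left _ _), le_max_right _ _, fun x x' => (hKl x x').trans
      (mul_le_mul_of_nonneg_right ((le_max_left _ _).trans (le_max_left _ _)) (norm_nonneg _))⟩
  have hh : ReachAvoid.IsBoundedLipschitz h (max Bl Bh) (max (max Kl Kh) 0) :=
    ⟨fun x => (hBh x).trans (le_max_right _ _), le_max_right _ _, fun x x' => (hKh x x').trans
      (mul_le_mul_of_nonneg_right ((le_max_right _ _).trans (le_max_left _ _)) (norm_nonneg _))⟩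
  have hval := ReachAvoid.isViscositySolution_value (T := T) hf hV hl hh
  refine ⟨fun t ht x u hu v hv => ?_, hval, fun x => ReachAvoid.value_terminal hf hl hh,
    fun w hw hwT => ?_⟩
  · have htraj := ReachAvoid.isTrajectory_trajectory hf ht.2 hu hv x
    exact ⟨htraj, fun y hy => hy.eqOn hf ht.2 hu hv htraj⟩
  · have hwv : ∀ x, w (x, T) = ReachAvoid.value f l h U V T (x, T) := fun x => by
      rw [hwT, ReachAvoid.value_terminal hf hl hh]
    rintro ⟨x, t⟩ ⟨-, ht⟩
    exact le_antisymm
      (ReachAvoid.le_of_isViscositySolution hf hh hw hval (fun x => (hwv x).le) x ht)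
      (ReachAvoid.le_of_isViscositySolution hf hh hval hw (fun x => (hwv x).ge) x ht)
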